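/- Let $k$ be a field. A variety over $k$ is a reduced separated scheme of finite type over $k$ (possibly empty or reducible). Let $\mathrm{Span}$ be the category whose objects are the varieties over $k$ and whose morphisms $X \dashrightarrow Y$ are the spans $X \hookleftarrow U \xrightarrow{p} Y$ over $k$ with $U$ an open subvariety of $X$ and $p$ proper; the composition of $X \hookleftarrow U \to Y$ and $Y \hookleftarrow V \to Z$ is $X \hookleftarrow U\times_Y V \to Z$. A proper morphism $f:X\to Y$ is regarded as the span $X = X \xrightarrow{f} Y$, and an open subvariety $U\subseteq X$ as the span $X \hookleftarrow U = U$ from $X$ to $U$. Let $\mathcal{C}$ be a stable $\infty$-category, and let $F:\mathrm{Span}^{\mathrm{op}}\to\mathcal{C}$ be a functor which has the localisation property: for every variety $X$ and every open subvariety $U\subseteq X$ with closed complement $X\setminus U$, the functor $F$ sends the commutative square $$\begin{array}{ccc} X\setminus U & \dashrightarrow & X\\ \downarrow & & \downarrow\\ \emptyset & \dashrightarrow & U\end{array}$$ in $\mathrm{Span}$ to a fibre sequence $F(U)\to F(X)\to F(X\setminus U)$, that is, $F(\emptyset)$ is a zero object and the image of the square is a pullback square in $\mathcal{C}$. Then $F$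 satisfies descent for abstract blowup squares: for every Cartesian square of varieties over $k$ $$\begin{array}{ccc} E & \to & Y\\ \downarrow & & \downarrow{\scriptstyle p}\\ C & \xrightarrow{\,i\,} & X\end{array}$$ such that $i$ is a closed immersion, $p$ is proper, and $p$ induces an isomorphism $p^{-1}(X\setminus C)\to X\setminus C$, the square $$\begin{array}{ccc} F(X) & \to & F(Y)\\ \downarrow & & \downarrow\\ F(C) & \to & F(E)\end{array}$$ is a pullback square in $\mathcal{C}$. -/

import Mathlib

open CategoryTheory AlgebraicGeometry Opposite Simplicial

universe w v u

/-! ### Diagrams in a quasi-category, limits and colimits -/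

/-- The type of diagrams `N(P) ⟶ C` in a simplicial set `C` indexed by a (small) preorder `P`,
i.e. maps of simplicial sets from the nerve of `P` to `C`. -/
abbrev Diag (P : Type) [Preorder P] (C : SSet.{w}) : Type w :=
  SSet.uliftFunctor.{w, 0}.obj (nerve P) ⟶ C

namespace Diag

variable {P Q R : Type} [Preorder P] [Preorder Q] [Preorder R] {C : SSet.{w}}

/-- Restriction of a diagram along a monotone map. -/
def restr (f : P →o Q) (τ : Diag Q C) : Diag P C :=
  SSet.uliftFunctor.{w, 0}.map (nerveMap f.monotone.functor) ≫ τ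

lemma restr_restr (f : P →o Q) (g : Q →o R) (τ : Diag R C) :
    restr f (restr g τ) = restr (g.comp f) τ := rfl

lemma restr_id (τ : Diag P C) : restr OrderHom.id τ = τ := rfl

/-- The vertex of a diagram at an element of the indexing preorder. -/
def vertex (τ : Diag P C) (x : P) : C _⦋0⦌ :=
  τ.app (op ⦋0⦌) ⟨ComposableArrows.mk₀ x⟩

/-- The edge of a diagram at a pair of comparable elements of the indexing preorder. -/
def edge (τ : Diag P C) {x y : P} (h : x ≤ y) : C _⦋1⦌ :=
  τ.app (op ⦋1⦌) ⟨ComposableArrows.mk₁ (homOfLE h)⟩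

end Diag

/-- The monotone map between ordinal sums (everything in the left summand is below
everything in the right summand) induced by monotone maps between the summands. -/
def lexSumMap {α α' β β' : Type} [Preorder α] [Preorder α'] [Preorder β] [Preorder β']
    (f : α →o α') (g : β →o β') : (α ⊕ₗ β) →o (α' ⊕ₗ β') where
  toFun x := toLex (Sum.map f g (ofLex x))
  monotone' := by
    intro x y h
    rw [Sum.Lex.le_def] at h ⊢
    cases h with
    | inl h => exact Sum.Lex.inl (f.monotone h)
    | inr h => exact Sum.Lex.inr (g.monotone h)
    | sep a b => exact Sum.Lex.sep _ _

/-- The inclusion of the left summand in an ordinal sum. -/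
def lexSumInl (α β : Type) [Preorder α] [Preorder β] : α →o (α ⊕ₗ β) :=
  ⟨Sum.inlₗ, Sum.Lex.inl_mono⟩

/-- The inclusion of the right summand in an ordinal sum. -/
def lexSumInr (α β : Type) [Preorder α] [Preorder β] : β →o (α ⊕ₗ β) :=
  ⟨Sum.inrₗ, Sum.Lex.inr_mono⟩

section Slices

variable {P : Type} [Preorder P] {C : SSet.{w}}

/-- The slice `C_{/p}` of a simplicial set over a diagram `p : N(P) ⟶ C`: its `n`-simplices are
the maps `Δⁿ ⋆ N(P) ⟶ C` which restrict to `p` on `N(P)`. Here the join `Δⁿ ⋆ N(P)` is the nerve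
of the ordinal sum of `[n] = {0 < ⋯ < n}` and `P`. -/
def sliceOver (p : Diag P C) : SSet.{w} where
  obj n := {τ : Diag (Fin (n.unop.len + 1) ⊕ₗ P) C // τ.restr (lexSumInr _ P) = p}
  map f := ↾ fun τ ↦ ⟨τ.1.restr (lexSumMap f.unop.toOrderHom OrderHom.id), τ.2⟩
  map_id n := by
    refine ConcreteCategory.hom_ext _ _ fun τ ↦ Subtype.ext ?_
    change τ.1.restr _ = τ.1
    convert Diag.restr_id τ.1
    ext x : 2
    rcases x with x | x <;> rfl
  map_comp f g := by
    refine ConcreteCategory.hom_ext _ _ fun τ ↦ Subtype.ext ?_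
    change τ.1.restr _ = (τ.1.restr _).restr _
    rw [Diag.restr_restr]
    congr 1
    ext x : 2
    rcases x with x | x <;> rfl

/-- The slice `C_{p/}` of a simplicial set under a diagram `p : N(P) ⟶ C`: its `n`-simplices are
the maps `N(P) ⋆ Δⁿ ⟶ C` which restrict to `p` on `N(P)`. -/
def sliceUnder (p : Diag P C) : SSet.{w} where
  obj n := {τ : Diag (P ⊕ₗ Fin (n.unop.len + 1)) C // τ.restr (lexSumInl P _) = p}
  map f := ↾ fun τ ↦ ⟨τ.1.restr (lexSumMap OrderHom.id f.unop.toOrderHom), τ.2⟩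
  map_id n := by
    refine ConcreteCategory.hom_ext _ _ fun τ ↦ Subtype.ext ?_
    change τ.1.restr _ = τ.1
    convert Diag.restr_id τ.1
    ext x : 2
    rcases x with x | x <;> rfl
  map_comp f g := by
    refine ConcreteCategory.hom_ext _ _ fun τ ↦ Subtype.ext ?_
    change τ.1.restr _ = (τ.1.restr _).restr _
    rw [Diag.restr_restr]
    congr 1
    ext x : 2
    rcases x with x | x <;> rfl

end Slices

/-- The `i`-th vertex of the boundary `∂Δⁿ⁺¹`. -/
def boundaryVertex (n : ℕ) (i : Fin (n + 2)) : (∂Δ[n + 1] : SSet.{w}) _⦋0⦌ :=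
  ⟨SSet.stdSimplex.const (n + 1) i (op ⦋0⦌), by
    rw [SSet.boundary_obj_eq_univ 0 (n + 1)]
    trivial⟩

/-- A vertex `x` of a simplicial set is final if every map `f : ∂Δⁿ ⟶ S`, `n ≥ 1`, sending the
last vertex to `x`, extends to `Δⁿ`. -/
def IsFinalVertex {S : SSet.{w}} (x : S _⦋0⦌) : Prop :=
  ∀ (n : ℕ) (f : (∂Δ[n + 1] : SSet.{w}) ⟶ S),
    f.app (op ⦋0⦌) (boundaryVertex n (Fin.last (n + 1))) = x →
      ∃ g : Δ[n + 1] ⟶ S, ∂Δ[n + 1].ι ≫ g = f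

/-- A vertex `x` of a simplicial set is initial if every map `f : ∂Δⁿ ⟶ S`, `n ≥ 1`, sending the
first vertex to `x`, extends to `Δⁿ`. -/
def IsInitialVertex {S : SSet.{w}} (x : S _⦋0⦌) : Prop :=
  ∀ (n : ℕ) (f : (∂Δ[n + 1] : SSet.{w}) ⟶ S),
    f.app (op ⦋0⦌) (boundaryVertex n 0) = x →
      ∃ g : Δ[n + 1] ⟶ S, ∂Δ[n + 1].ι ≫ g = f

/-- A zero object: an object which is both initial and final. -/
def IsZeroVertex {S : SSet.{w}} (x : S _⦋0⦌) : Prop :=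
  IsInitialVertex x ∧ IsFinalVertex x

/-! ### Squares -/

/-- The poset `[1] × [1]`, whose nerve is `Δ¹ × Δ¹`. The element `(i, j)` is thought of as
the position in row `i` and column `j` of a square. -/
def SquareShape : Type := Fin 2 × Fin 2

namespace SquareShape

instance : PartialOrder SquareShape := inferInstanceAs (PartialOrder (Fin 2 × Fin 2))

/-- The top left position. -/
def tl : SquareShape := ((0, 0) : Fin 2 × Fin 2)
/-- The top right position. -/
def tr : SquareShape := ((0, 1) : Fin 2 × Fin 2)
/-- The bottom left position. -/
def bl : SquareShape := ((1, 0) : Fin 2 × Fin 2)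
/-- The bottom right position. -/
def br : SquareShape := ((1, 1) : Fin 2 × Fin 2)

lemma tl_le (x : SquareShape) : tl ≤ x := Prod.mk_le_mk.2 ⟨Fin.zero_le _, Fin.zero_le _⟩
lemma le_br (x : SquareShape) : x ≤ br := Prod.mk_le_mk.2 ⟨Fin.le_last _, Fin.le_last _⟩

end SquareShape

open SquareShape

/-- The poset `tr → br ← bl`. -/
abbrev CospanShape : Type := {x : SquareShape // x ≠ tl}

/-- The poset `tr ← tl → bl`. -/
abbrev SpanShape : Type := {x : SquareShape // x ≠ br}

/-- The (iso)morphism of posets from the cone `[0] ⋆ CospanShape` to `SquareShape`. -/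
def cospanConeHom : (Fin 1 ⊕ₗ CospanShape) →o SquareShape where
  toFun x := Sum.elim (fun _ ↦ tl) Subtype.val (ofLex x)
  monotone' := by
    intro x y h
    rw [Sum.Lex.le_def] at h
    cases h with
    | inl h => exact le_rfl
    | inr h => exact h
    | sep a b => exact tl_le _

/-- The (iso)morphism of posets from the cocone `SpanShape ⋆ [0]` to `SquareShape`. -/
def spanCoconeHom : (SpanShape ⊕ₗ Fin 1) →o SquareShape where
  toFun x := Sum.elim Subtype.val (fun _ ↦ br) (ofLex x)
  monotone' := by
    intro x y h
    rw [Sum.Lex.le_def] at h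
    cases h with
    | inl h => exact h
    | inr h => exact le_rfl
    | sep a b => exact le_br _

section Squares

variable {C : SSet.{w}}

/-- The cospan underlying a square `Δ¹ × Δ¹ ⟶ C`. -/
def Diag.cospan (σ : Diag SquareShape C) : Diag CospanShape C :=
  σ.restr (OrderHom.Subtype.val _)

/-- The span underlying a square `Δ¹ × Δ¹ ⟶ C`. -/
def Diag.span (σ : Diag SquareShape C) : Diag SpanShape C :=
  σ.restr (OrderHom.Subtype.val _)

/-- A square `σ : Δ¹ × Δ¹ ⟶ C` is a pullback square if it is a limit cone over the underlying
cospan `p`, i.e. if the corresponding vertex of `C_{/p}` is final. -/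
def IsPullbackSquare (σ : Diag SquareShape C) : Prop :=
  IsFinalVertex (S := sliceOver σ.cospan)
    (show {τ : Diag (Fin 1 ⊕ₗ CospanShape) C // τ.restr (lexSumInr _ _) = σ.cospan} from
      ⟨σ.restr cospanConeHom, rfl⟩)

/-- A square `σ : Δ¹ × Δ¹ ⟶ C` is a pushout square if it is a colimit cocone under the underlying
span `p`, i.e. if the corresponding vertex of `C_{p/}` is initial. -/
def IsPushoutSquare (σ : Diag SquareShape C) : Prop :=
  IsInitialVertex (S := sliceUnder σ.span)
    (show {τ : Diag (SpanShape ⊕ₗ Fin 1) C // τ.restr (lexSumInl _ _) = σ.span} from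
      ⟨σ.restr spanCoconeHom, rfl⟩)

/-- A triangle in `C`: a square
```
X → Y
↓   ↓
0 → Z
```
where `0` is a zero object of `C`. -/
def IsTriangle (σ : Diag SquareShape C) : Prop :=
  IsZeroVertex (σ.vertex bl)

/-- A fibre sequence: a triangle which is a pullback square. -/
def IsFibreSequence (σ : Diag SquareShape C) : Prop :=
  IsTriangle σ ∧ IsPullbackSquare σ

/-- A cofibre sequence: a triangle which is a pushout square. -/
def IsCofibreSequence (σ : Diag SquareShape C) : Prop :=
  IsTriangle σ ∧ IsPushoutSquare σ

end Squares

/-- Stable `∞`-categories: quasi-categories with a zero object, in which every morphism has a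
fibre and a cofibre, and in which a triangle is a fibre sequence if and only if it is a cofibre
sequence. -/
structure IsStableInftyCategory (C : SSet.{w}) : Prop where
  quasicategory : SSet.Quasicategory C
  exists_zero : ∃ x : C _⦋0⦌, IsZeroVertex x
  exists_fibre (g : C _⦋1⦌) :
    ∃ σ : Diag SquareShape C, IsFibreSequence σ ∧ σ.edge (tr.le_br) = g
  exists_cofibre (f : C _⦋1⦌) :
    ∃ σ : Diag SquareShape C, IsCofibreSequence σ ∧ σ.edge (tr.tl_le) = f
  fibre_iff_cofibre (σ : Diag SquareShape C) : IsFibreSequence σ ↔ IsCofibreSequence σ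

/-! ### Functors from an ordinary category to an `∞`-category -/

/-- Functors from an ordinary category `D` to an `∞`-category `C`: maps of simplicial sets from
the nerve of `D` to `C`. -/
abbrev InftyFunctor (D : Type u) [Category.{v} D] (C : SSet.{max u v w}) : Type (max u v w) :=
  SSet.uliftFunctor.{w, max u v}.obj (nerve D) ⟶ C

/-- The identification of the poset `[1] × [1]` with the product of the categories `[1]`. -/
def squareShapeToProd : SquareShape ⥤ Fin 2 × Fin 2 where
  obj x := x
  map f := Prod.mkHom (homOfLE (leOfHom f).1) (homOfLE (leOfHom f).2)

/-- The functor `[1] × [1] ⥤ D` given by a commutative square in a category `D`, with the top row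
`X₁ ⟶ X₂` and the bottom row `X₃ ⟶ X₄` of the square as its rows. -/
def squareFunctor {D : Type u} [Category.{v} D] (sq : Square D) : SquareShape ⥤ D :=
  squareShapeToProd ⋙ Functor.uncurry.obj (ComposableArrows.mk₁
    (ComposableArrows.homMk₁ sq.f₁₃ sq.f₂₄ sq.fac :
      ComposableArrows.mk₁ sq.f₁₂ ⟶ ComposableArrows.mk₁ sq.f₃₄))

namespace InftyFunctor

variable {D : Type u} [Category.{v} D] {C : SSet.{max u v w}}

/-- The diagram in `C` obtained by composing a functor `F` from `D` to `C` with a diagram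
`G : P ⥤ D`. -/
def comp (F : InftyFunctor.{w} D C) {P : Type} [Preorder P] (G : P ⥤ D) : Diag P C where
  app n := ↾ fun x ↦ F.app n ⟨(show ComposableArrows P n.unop.len from x.down) ⋙ G⟩
  naturality := by
    intro m n f
    refine ConcreteCategory.hom_ext _ _ fun x ↦ ?_
    exact ConcreteCategory.congr_hom (F.naturality f)
      (show (SSet.uliftFunctor.{w, max u v}.obj (nerve D)).obj m from
        ⟨(show ComposableArrows P m.unop.len from x.down) ⋙ G⟩)

/-- The image in `C` of a commutative square in `D`. -/
def mapSquare (F : InftyFunctor.{w} D C) (sq : Square D) : Diag SquareShape C :=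
  F.comp (squareFunctor sq)

end InftyFunctor

/-! ### Varieties -/

/-- The category of varieties over a field `k`: reduced separated schemes of finite type over `k`
(not necessarily irreducible or connected, possibly empty), with morphisms of `k`-schemes. -/
abbrev Variety (k : Type u) [Field k] : Type (u + 1) :=
  ObjectProperty.FullSubcategory fun X : Over (Spec (CommRingCat.of k)) ↦
    IsReduced X.left ∧ IsSeparated X.hom ∧ LocallyOfFiniteType X.hom ∧ QuasiCompact X.hom

namespace Variety

variable {k : Type u} [Field k]

/-- The underlying scheme of a variety. -/
noncomputable abbrev sch (X : Variety k) : Scheme.{u} := X.obj.left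

/-- The structure morphism of a variety. -/
noncomputable abbrev str (X : Variety k) : X.sch ⟶ Spec (CommRingCat.of k) := X.obj.hom

/-- The morphism of schemes underlying a morphism of varieties. -/
noncomputable abbrev mor {X Y : Variety k} (f : X ⟶ Y) : X.sch ⟶ Y.sch := f.hom.left

instance (X : Variety k) : IsReduced X.sch := X.property.1
instance (X : Variety k) : IsSeparated X.str := X.property.2.1
instance (X : Variety k) : LocallyOfFiniteType X.str := X.property.2.2.1
instance (X : Variety k) : QuasiCompact X.str := X.property.2.2.2

lemma mor_str {X Y : Variety k} (f : X ⟶ Y) : mor f ≫ Y.str = X.str := Over.w f.hom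

/-- The empty variety. -/
noncomputable def empty (k : Type u) [Field k] : Variety k where
  obj := Over.mk (Scheme.emptyTo (Spec (CommRingCat.of k)))
  property := by
    refine ⟨?_, ?_, ?_, ?_⟩
    all_goals dsimp
    · exact ⟨fun U ↦ (inferInstance : IsReduced PUnit)⟩
    all_goals infer_instance

instance : IsEmpty (empty k).sch := inferInstanceAs (IsEmpty (∅ : Scheme.{u}))

end Variety

/-! ### The category of spans -/

/-- A span `X ↩ U ⟶ Y` from `X` to `Y`, with `U` an open subvariety of `X` and `U ⟶ Y` a proper
morphism of `k`-schemes. -/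
structure ProperSpan {k : Type u} [Field k] (X Y : Variety k) : Type u where
  /-- the open subvariety on which the span is defined -/
  dom : X.sch.Opens
  /-- the proper morphism -/
  map : (dom : Scheme.{u}) ⟶ Y.sch
  isProper : IsProper map
  w : map ≫ Y.str = dom.ι ≫ X.str

attribute [instance] ProperSpan.isProper

namespace ProperSpan

variable {k : Type u} [Field k] {X Y Z W : Variety k}

lemma ext_of_le {f g : ProperSpan X Y} (h : f.dom = g.dom)
    (h' : f.map = X.sch.homOfLE h.le ≫ g.map) : f = g := by
  obtain ⟨U, p, _, _⟩ := f
  obtain ⟨V, q, _, _⟩ := g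
  obtain rfl : U = V := h
  obtain rfl : p = q := by simpa using h'
  rfl

/-- The identity span `X = X = X`. -/
noncomputable abbrev id (X : Variety k) : ProperSpan X X where
  dom := ⊤
  map := Scheme.Opens.ι ⊤
  isProper := by
    rw [← Scheme.topIso_hom]
    infer_instance
  w := rfl

/-- For spans `X ↩ U ⟶ Y` and `Y ↩ V ⟶ Z`, the open subvariety `U ×_Y V` of `X`, i.e. the
preimage of `V` in `U`. -/
noncomputable abbrev compDom (f : ProperSpan X Y) (g : ProperSpan Y Z) : X.sch.Opens :=
  f.dom.ι ''ᵁ (f.map ⁻¹ᵁ g.dom)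

lemma compDom_le (f : ProperSpan X Y) (g : ProperSpan Y Z) : f.compDom g ≤ f.dom := by
  rintro _ ⟨x, _, rfl⟩
  exact x.2

/-- For spans `X ↩ U ⟶ Y` and `Y ↩ V ⟶ Z`, the projection `U ×_Y V ⟶ V`. -/
noncomputable def compProj (f : ProperSpan X Y) (g : ProperSpan Y Z) :
    (f.compDom g : Scheme.{u}) ⟶ g.dom :=
  (f.dom.ι.isoImage (f.map ⁻¹ᵁ g.dom)).inv ≫ (f.map ∣_ g.dom)

instance (f : ProperSpan X Y) (g : ProperSpan Y Z) : IsProper (f.compProj g) := by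
  unfold compProj
  infer_instance

lemma compProj_ι (f : ProperSpan X Y) (g : ProperSpan Y Z) :
    f.compProj g ≫ g.dom.ι = X.sch.homOfLE (f.compDom_le g) ≫ f.map := by
  have : (f.dom.ι.isoImage (f.map ⁻¹ᵁ g.dom)).inv ≫ (f.map ⁻¹ᵁ g.dom).ι =
      X.sch.homOfLE (f.compDom_le g) := by
    rw [← cancel_mono f.dom.ι]
    simp [compDom]
  rw [compProj, Category.assoc, morphismRestrict_ι, reassoc_of% this]

/-- The composition of spans, given by the fibre product. -/
noncomputable abbrev comp (f : ProperSpan X Y) (g : ProperSpan Y Z) : ProperSpan X Z where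
  dom := f.compDom g
  map := f.compProj g ≫ g.map
  isProper := inferInstance
  w := by
    rw [Category.assoc, g.w, reassoc_of% f.compProj_ι g, f.w, Scheme.homOfLE_ι_assoc]

lemma mem_compDom (f : ProperSpan X Y) (g : ProperSpan Y Z) (x : X.sch) :
    x ∈ f.compDom g ↔ ∃ h : x ∈ f.dom, f.map ⟨x, h⟩ ∈ g.dom := by
  constructor
  · rintro ⟨y, hy, rfl⟩
    exact ⟨y.2, hy⟩
  · rintro ⟨h, h'⟩
    exact ⟨⟨x, h⟩, h', rfl⟩

lemma id_comp (f : ProperSpan X Y) : (id X).comp f = f := by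
  have h : (id X).compDom f = f.dom := by
    ext x
    rw [SetLike.mem_coe, SetLike.mem_coe, mem_compDom]
    exact ⟨fun ⟨_, h⟩ ↦ h, fun h ↦ ⟨trivial, h⟩⟩
  have h' : (id X).compProj f = X.sch.homOfLE h.le := by
    rw [← cancel_mono f.dom.ι, compProj_ι, Scheme.homOfLE_ι, Scheme.homOfLE_ι]
  exact ext_of_le h congr($h' ≫ f.map)

lemma comp_id (f : ProperSpan X Y) : f.comp (id Y) = f := by
  have h : f.compDom (id Y) = f.dom := by
    ext x
    rw [SetLike.mem_coe, SetLike.mem_coe, mem_compDom]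
    exact ⟨fun ⟨h, _⟩ ↦ h, fun h ↦ ⟨h, trivial⟩⟩
  exact ext_of_le h (f.compProj_ι (id Y))

lemma assoc (f : ProperSpan X Y) (g : ProperSpan Y Z) (h : ProperSpan Z W) :
    (f.comp g).comp h = f.comp (g.comp h) := by
  have key (x : X.sch) (hx : x ∈ f.compDom g) :
      g.dom.ι (f.compProj g ⟨x, hx⟩) = f.map ⟨x, f.compDom_le g hx⟩ := by
    refine (Scheme.Hom.comp_apply _ _ _).symm.trans ?_
    rw [compProj_ι]
    refine (Scheme.Hom.comp_apply _ _ _).trans ?_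
    exact congrArg f.map (Scheme.homOfLE_apply' _ _ _)
  have hdom : (f.comp g).compDom h = f.compDom (g.comp h) := by
    ext x
    refine ((f.comp g).mem_compDom h x).trans (Iff.trans ?_ (f.mem_compDom (g.comp h) x).symm)
    constructor
    · rintro ⟨hx, hx'⟩
      refine ⟨f.compDom_le g hx, (g.mem_compDom h _).2 ?_⟩
      rw [← key x hx]
      exact ⟨(f.compProj g ⟨x, hx⟩).2, hx'⟩
    · rintro ⟨hx, hx'⟩
      obtain ⟨h₁, h₂⟩ := (g.mem_compDom h _).1 hx'
      have hx₂ : x ∈ f.compDom g := (f.mem_compDom g x).2 ⟨hx, h₁⟩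
      refine ⟨hx₂, ?_⟩
      change g.map (f.compProj g ⟨x, hx₂⟩) ∈ h.dom
      have : f.compProj g ⟨x, hx₂⟩ = ⟨f.map ⟨x, hx⟩, h₁⟩ := Subtype.ext (key x hx₂)
      rwa [this]
  have h₁ : X.sch.homOfLE ((f.comp g).compDom_le h) ≫ f.compProj g =
      X.sch.homOfLE hdom.le ≫ f.compProj (g.comp h) ≫ Y.sch.homOfLE (g.compDom_le h) := by
    rw [← cancel_mono g.dom.ι, Category.assoc, Category.assoc, Category.assoc, compProj_ι,
      Scheme.homOfLE_ι, Scheme.homOfLE_homOfLE_assoc]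
    have := f.compProj_ι (g.comp h)
    exact ((congr(X.sch.homOfLE hdom.le ≫ $this)).trans
      (Scheme.homOfLE_homOfLE_assoc _ _ _ _)).symm
  have h₂ : (f.comp g).compProj h =
      X.sch.homOfLE hdom.le ≫ f.compProj (g.comp h) ≫ g.compProj h := by
    rw [← cancel_mono h.dom.ι, compProj_ι, Category.assoc, Category.assoc, compProj_ι]
    exact (Category.assoc _ _ _).symm.trans ((congr($h₁ ≫ g.map)).trans (by
      simp only [Category.assoc]))
  exact ext_of_le hdom ((congr($h₂ ≫ h.map)).trans (by simp only [Category.assoc]))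

end ProperSpan

/-- The category `Span`: its objects are the varieties over `k`, and a morphism `X ⇢ Y` is a span
`X ↩ U ⟶ Y` with `U` an open subvariety of `X` and `U ⟶ Y` proper. -/
structure VarSpan (k : Type u) [Field k] : Type (u + 1) where
  /-- the underlying variety -/
  of : Variety k

noncomputable instance (k : Type u) [Field k] : Category.{u} (VarSpan k) where
  Hom X Y := ProperSpan X.of Y.of
  id X := ProperSpan.id X.of
  comp f g := ProperSpan.comp f g
  id_comp := ProperSpan.id_comp
  comp_id := ProperSpan.comp_id
  assoc := ProperSpan.assoc

/-! ### Special morphisms and squares of spans -/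

namespace Variety

variable {k : Type u} [Field k] {X Y Z U : Variety k}

/-- The morphism `X ⇢ Y` of `Span` given by a proper morphism of varieties `f : X ⟶ Y`, i.e. the
span `X = X ⟶ Y`. -/
noncomputable def spanOfProper (f : X ⟶ Y) [IsProper (mor f)] :
    (⟨X⟩ : VarSpan k) ⟶ ⟨Y⟩ where
  dom := ⊤
  map := Scheme.Opens.ι ⊤ ≫ mor f
  isProper := by
    rw [← Scheme.topIso_hom]
    infer_instance
  w := by rw [Category.assoc, mor_str]

/-- The morphism `X ⇢ U` of `Span` given by an open immersion of varieties `j : U ⟶ X`, i.e. the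
span `X ↩ U = U`. -/
noncomputable def spanOfOpen (j : U ⟶ X) [IsOpenImmersion (mor j)] :
    (⟨X⟩ : VarSpan k) ⟶ ⟨U⟩ where
  dom := (mor j).opensRange
  map := (mor j).isoOpensRange.inv
  isProper := inferInstance
  w := by
    rw [Iso.inv_comp_eq, Scheme.Hom.isoOpensRange_hom_ι_assoc, mor_str]

instance (X : Scheme.{u}) : IsEmpty ((⊥ : X.Opens) : Scheme.{u}) := ⟨fun x ↦ x.2⟩

/-- The zero morphism `X ⇢ ∅` of `Span`, i.e. the span `X ↩ ∅ = ∅`. -/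
noncomputable def spanToEmpty (X : Variety k) : (⟨X⟩ : VarSpan k) ⟶ ⟨empty k⟩ where
  dom := ⊥
  map := (isInitialOfIsEmpty (X := ((⊥ : X.sch.Opens) : Scheme.{u}))).to _
  isProper := inferInstance
  w := isInitialOfIsEmpty.hom_ext _ _

/-- The morphism of varieties `∅ ⟶ X`. -/
noncomputable def fromEmpty (X : Variety k) : empty k ⟶ X :=
  ObjectProperty.homMk (Over.homMk (Scheme.emptyTo X.sch) (Scheme.empty_ext _ _))

lemma spanOfProper_comp (f : X ⟶ Y) (g : Y ⟶ Z) [IsProper (mor f)] [IsProper (mor g)]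
    [IsProper (mor (f ≫ g))] :
    spanOfProper f ≫ spanOfProper g = spanOfProper (f ≫ g) := by
  have h : ProperSpan.compDom (spanOfProper f) (spanOfProper g) = ⊤ := by
    ext x
    rw [SetLike.mem_coe, SetLike.mem_coe, ProperSpan.mem_compDom]
    exact ⟨fun _ ↦ trivial, fun _ ↦ ⟨trivial, trivial⟩⟩
  refine ProperSpan.ext_of_le h ?_
  have h₁ := ProperSpan.compProj_ι (spanOfProper f) (spanOfProper g)
  refine ((Category.assoc _ _ _).symm.trans (congr($h₁ ≫ mor g))).trans ?_
  change (_ ≫ Scheme.Opens.ι ⊤ ≫ mor f) ≫ mor g = _ ≫ Scheme.Opens.ι ⊤ ≫ mor f ≫ mor g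
  exact Category.assoc _ _ _

/-- For a closed immersion `i : Z ⟶ X` and an open immersion `j : U ⟶ X` with complementary images,
i.e. for `U` an open subvariety of `X` and `Z = X ∖ U` its closed complement (with its reduced
structure, as `Z` is a variety), the localisation square in `Span`:
```
X ∖ U ⇢ X
  ↓     ↓
  ∅   ⇢ U
```
-/
noncomputable def localisationSquare (i : Z ⟶ X) (j : U ⟶ X) [IsClosedImmersion (mor i)]
    [IsOpenImmersion (mor j)] (h : Set.range (mor i) = (Set.range (mor j))ᶜ) :
    Square (VarSpan k) where
  f₁₂ := spanOfProper i
  f₁₃ := spanToEmpty Z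
  f₂₄ := spanOfOpen j
  f₃₄ := spanOfProper (fromEmpty U)
  fac := by
    have h₁ : ProperSpan.compDom (spanOfProper i) (spanOfOpen j) = ⊥ := by
      ext x
      rw [SetLike.mem_coe, SetLike.mem_coe, ProperSpan.mem_compDom]
      refine ⟨fun ⟨_, hx⟩ ↦ ?_, fun hx ↦ hx.elim⟩
      have hx₁ : mor i x ∈ Set.range (mor j) := hx
      have hx₂ : mor i x ∈ Set.range (mor i) := ⟨x, rfl⟩
      rw [h] at hx₂
      exact hx₂ hx₁
    have h₂ : ProperSpan.compDom (spanToEmpty Z) (spanOfProper (fromEmpty U)) = ⊥ := by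
      ext x
      rw [SetLike.mem_coe, SetLike.mem_coe, ProperSpan.mem_compDom]
      exact ⟨fun ⟨hx, _⟩ ↦ hx, fun hx ↦ hx.elim⟩
    refine ProperSpan.ext_of_le (h₁.trans h₂.symm) ?_
    have : IsEmpty (ProperSpan.compDom (spanOfProper i) (spanOfOpen j) : Scheme.{u}) := by
      rw [h₁]
      infer_instance
    exact isInitialOfIsEmpty.hom_ext _ _

/-- A Cartesian square of varieties
```
E → Y
↓   ↓ p
C → X
  i
```
is an abstract blowup square if `i` is a closed immersion, `p` is proper, and `p` induces an
isomorphism `p⁻¹(X ∖ C) ≅ X ∖ C`. -/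
structure IsAbstractBlowupSquare {E Y C X : Variety k} (i' : E ⟶ Y) (p' : E ⟶ C) (p : Y ⟶ X)
    (i : C ⟶ X) : Prop where
  isPullback : IsPullback i' p' p i
  isClosedImmersion : IsClosedImmersion (mor i)
  isProper : IsProper (mor p)
  isIso : IsIso (mor p ∣_
    ⟨(Set.range (mor i))ᶜ, (mor i).isClosedEmbedding.isClosed_range.isOpen_compl⟩)

/-- The scheme-theoretic image of a reduced scheme is reduced. -/
lemma isReduced_image {S T : Scheme.{u}} (f : S ⟶ T) [QuasiCompact f] [IsReduced S] :
    IsReduced f.image := by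
  refine ⟨fun V ↦ ⟨fun s hs ↦ f.image.IsSheaf.section_ext fun x hx ↦ ?_⟩⟩
  obtain ⟨_, ⟨_, ⟨W, hW, rfl⟩, rfl⟩, hxW, hWV⟩ :=
    (T.isBasis_affineOpens.of_isInducing f.imageι.isEmbedding.isInducing).exists_subset_of_mem_open
      hx V.isOpen
  refine ⟨f.imageι ⁻¹ᵁ W, hWV, hxW, ?_⟩
  refine f.toImage_app_injective ⟨W, hW⟩ ?_
  rw [map_zero, map_zero]
  exact ((hs.map (f.image.presheaf.map (homOfLE hWV).op).hom).map
    (f.toImage.app (f.imageι ⁻¹ᵁ W)).hom).eq_zero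

/-- In a Cartesian square of varieties, the canonical map to the fibre product of schemes is a closed
immersion. -/
lemma isClosedImmersion_lift {E Y C X : Variety k} {i' : E ⟶ Y} {p' : E ⟶ C} {p : Y ⟶ X}
    {i : C ⟶ X} (h : IsPullback i' p' p i) :
    IsClosedImmersion (Limits.pullback.lift (mor i') (mor p')
      (show mor i' ≫ mor p = mor p' ≫ mor i from congr(mor $h.w))) := by
  have hw : mor i' ≫ mor p = mor p' ≫ mor i := congr(mor $h.w)
  change IsClosedImmersion (Limits.pullback.lift (mor i') (mor p') hw)
  set P := Limits.pullback (mor p) (mor i)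
  set l : E.sch ⟶ P := Limits.pullback.lift (mor i') (mor p') hw with hl
  have hl₁ : l ≫ Limits.pullback.fst _ _ = mor i' := Limits.pullback.lift_fst _ _ _
  have hl₂ : l ≫ Limits.pullback.snd _ _ = mor p' := Limits.pullback.lift_snd _ _ _
  have : LocallyOfFiniteType (mor i ≫ X.str) := by rw [mor_str]; infer_instance
  have : IsSeparated (mor i ≫ X.str) := by rw [mor_str]; infer_instance
  have : QuasiCompact (mor i ≫ X.str) := by rw [mor_str]; infer_instance
  have : LocallyOfFiniteType (mor i) := locallyOfFiniteType_of_comp _ X.str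
  have : IsSeparated (mor i) := IsSeparated.of_comp _ X.str
  have : QuasiCompact (mor i) := QuasiCompact.of_comp _ X.str
  let s : P ⟶ Spec (CommRingCat.of k) := Limits.pullback.fst _ _ ≫ Y.str
  have hs : l ≫ s = E.str := by
    rw [← mor_str i', ← hl₁, Category.assoc]
  have : QuasiCompact (l ≫ s) := by rw [hs]; infer_instance
  have : IsSeparated s := inferInstanceAs (IsSeparated (_ ≫ _))
  have : QuasiCompact l := QuasiCompact.of_comp l s
  have : IsReduced l.image := isReduced_image l
  let Q : Variety k :=
    { obj := Over.mk (l.imageι ≫ s)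
      property := ⟨this, inferInstanceAs (IsSeparated (l.imageι ≫ Limits.pullback.fst _ _ ≫ Y.str)),
        inferInstanceAs (LocallyOfFiniteType (l.imageι ≫ Limits.pullback.fst _ _ ≫ Y.str)),
        inferInstanceAs (QuasiCompact (l.imageι ≫ Limits.pullback.fst _ _ ≫ Y.str))⟩ }
  let a : Q ⟶ Y := ObjectProperty.homMk (Over.homMk (l.imageι ≫ Limits.pullback.fst _ _)
    (Category.assoc _ _ _))
  have hb : (l.imageι ≫ Limits.pullback.snd (mor p) (mor i)) ≫ C.str = l.imageι ≫ s := by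
    rw [Category.assoc]
    congr 1
    rw [← mor_str i, ← Limits.pullback.condition_assoc, mor_str]
  let b : Q ⟶ C := ObjectProperty.homMk (Over.homMk (l.imageι ≫ Limits.pullback.snd _ _) hb)
  have hab : a ≫ p = b ≫ i := by
    apply ObjectProperty.hom_ext
    apply Over.OverMorphism.ext
    change (l.imageι ≫ Limits.pullback.fst _ _) ≫ mor p =
      (l.imageι ≫ Limits.pullback.snd _ _) ≫ mor i
    rw [Category.assoc, Category.assoc, Limits.pullback.condition]
  let r : Q ⟶ E := h.lift a b hab
  have hr : mor r ≫ l = l.imageι := by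
    apply Limits.pullback.hom_ext
    · rw [Category.assoc, hl₁]
      exact congr(mor $(h.lift_fst a b hab))
    · rw [Category.assoc, hl₂]
      exact congr(mor $(h.lift_snd a b hab))
  let t : E ⟶ Q := ObjectProperty.homMk (Over.homMk l.toImage
    (by
      change l.toImage ≫ l.imageι ≫ s = E.str
      rw [Scheme.Hom.toImage_imageι_assoc, hs]))
  have ht₁ : t ≫ a = i' := by
    apply ObjectProperty.hom_ext
    apply Over.OverMorphism.ext
    change l.toImage ≫ l.imageι ≫ _ = mor i'
    rw [Scheme.Hom.toImage_imageι_assoc, hl₁]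
  have ht₂ : t ≫ b = p' := by
    apply ObjectProperty.hom_ext
    apply Over.OverMorphism.ext
    change l.toImage ≫ l.imageι ≫ _ = mor p'
    rw [Scheme.Hom.toImage_imageι_assoc, hl₂]
  have htr : t ≫ r = 𝟙 E := by
    apply h.hom_ext
    · rw [Category.assoc, h.lift_fst, ht₁, Category.id_comp]
    · rw [Category.assoc, h.lift_snd, ht₂, Category.id_comp]
  have hrt : mor r ≫ l.toImage = 𝟙 _ := by
    rw [← cancel_mono l.imageι, Category.assoc, Scheme.Hom.toImage_imageι, hr]
    exact (Category.id_comp _).symm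
  have : IsIso l.toImage := ⟨mor r, congr(mor $htr), hrt⟩
  rw [← l.toImage_imageι]
  infer_instance

lemma IsAbstractBlowupSquare.isProper_top {E Y C X : Variety k} {i' : E ⟶ Y} {p' : E ⟶ C}
    {p : Y ⟶ X} {i : C ⟶ X} (h : IsAbstractBlowupSquare i' p' p i) : IsProper (mor i') := by
  have := isClosedImmersion_lift h.isPullback
  have := h.isClosedImmersion
  rw [← Limits.pullback.lift_fst (f := mor p) (g := mor i) (mor i') (mor p')
      (show mor i' ≫ mor p = mor p' ≫ mor i from congr(mor $h.isPullback.w))]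
  infer_instance

lemma IsAbstractBlowupSquare.isProper_left {E Y C X : Variety k} {i' : E ⟶ Y} {p' : E ⟶ C}
    {p : Y ⟶ X} {i : C ⟶ X} (h : IsAbstractBlowupSquare i' p' p i) : IsProper (mor p') := by
  have := isClosedImmersion_lift h.isPullback
  have := h.isProper
  rw [← Limits.pullback.lift_snd (f := mor p) (g := mor i) (mor i') (mor p')
      (show mor i' ≫ mor p = mor p' ≫ mor i from congr(mor $h.isPullback.w))]
  infer_instance

/-- An abstract blowup square, considered as a commutative square in `Span`. -/
noncomputable def IsAbstractBlowupSquare.square {E Y C X : Variety k} {i' : E ⟶ Y} {p' : E ⟶ C}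
    {p : Y ⟶ X} {i : C ⟶ X} (h : IsAbstractBlowupSquare i' p' p i) : Square (VarSpan k) :=
  have := h.isProper_top
  have := h.isProper_left
  have := h.isProper
  have := h.isClosedImmersion
  { f₁₂ := spanOfProper i'
    f₁₃ := spanOfProper p'
    f₂₄ := spanOfProper p
    f₃₄ := spanOfProper i
    fac := by
      have h₁ : IsProper (mor (i' ≫ p)) := inferInstanceAs (IsProper (mor i' ≫ mor p))
      have h₂ : IsProper (mor (p' ≫ i)) := inferInstanceAs (IsProper (mor p' ≫ mor i))
      rw [spanOfProper_comp, spanOfProper_comp]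
      congr 1
      exact h.isPullback.w }

end Variety

/-! ### Presheaves on `Span` with values in an `∞`-category -/

section Presheaves

variable {k : Type u} [Field k] {C : SSet.{max (u + 1) w}}

/-- A presheaf `F` on `Span` has the localisation property if for every open subvariety `U` of a
variety `X` it sends the localisation square of `U ⊆ X` to a fibre sequence
`F(U) ⟶ F(X) ⟶ F(X ∖ U)`, i.e. if `F(∅)` is a zero object and the square
```
F(U) → F(X)
 ↓      ↓
F(∅) → F(X ∖ U)
```
is a pullback square. -/
def HasLocalisationProperty (F : InftyFunctor.{w} (VarSpan k)ᵒᵖ C) : Prop :=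
  ∀ ⦃X Z U : Variety k⦄ (i : Z ⟶ X) (j : U ⟶ X) [IsClosedImmersion (Variety.mor i)]
    [IsOpenImmersion (Variety.mor j)]
    (h : Set.range (Variety.mor i) = (Set.range (Variety.mor j))ᶜ),
    IsFibreSequence (F.mapSquare (Variety.localisationSquare i j h).op)

/-- A presheaf `F` on `Span` satisfies descent for abstract blowups if it sends every abstract
blowup square to a pullback square
```
F(X) → F(Y)
 ↓      ↓
F(C) → F(E)
```
-/
def HasAbstractBlowupDescent (F : InftyFunctor.{w} (VarSpan k)ᵒᵖ C) : Prop :=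
  ∀ ⦃E Y C X : Variety k⦄ (i' : E ⟶ Y) (p' : E ⟶ C) (p : Y ⟶ X) (i : C ⟶ X)
    (h : Variety.IsAbstractBlowupSquare i' p' p i),
    IsPullbackSquare (F.mapSquare h.square.op)

end Presheaves

/-! Put `U = X ∖ C`. As `p` is an isomorphism over `U`, the variety `U` is also open in `Y`, with
complement the image of the closed immersion `E → Y`. In `Span` the composite `Y → X ⇢ U` is the
restriction `Y ⇢ U`. Consider the rectangle with rows `F(U) → F(X) → F(Y)` and `F(∅) → F(C) → F(E)`.
Its left and outer squares are images of localisation squares, hence fibre sequences; its right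
square is the one of the theorem.

In a stable ∞-category this forces the right square to be a pullback
(`IsStableInftyCategory.isPullbackSquare_right`). The two fibre sequences are cofibre sequences, so
by pasting the right square is a pushout. Any pushout square is a pullback: attach the cofibre of
its right column; the attached square and the new outer square are cofibre sequences, hence fibre
sequences, and pasting for pullbacks applies.

The quasi-categorical input is the pasting law (`isPullbackSquare_left_iff`), its dual, obtained by
reversing simplices (`AntiIso`), and the gluing of two squares along an edge (`exists_rectangle`).
The main tool is `IsToggle.exists_extension`: if the nondegenerate simplices of `N(Q)` outside a
subcomplex come in pairs `s`, `s ∪ {v}` with `v` an inner vertex of `s ∪ {v}`, the inclusion of the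
subcomplex is inner anodyne. For pasting, limit cones over different bases are compared along
`C_{/p} → C_{/pf}`. This map is a trivial fibration, so it preserves and reflects final vertices,
when the element omitted by `f` is redundant (`sliceOverMap_rlp_of_lt`) or is itself the limit of
what lies above it (`sliceOverMap_rlp_of_isFinalVertex`). -/

/-! ### Simplices of nerves of preorders -/

namespace Diag

variable {P Q R : Type} [Preorder P] [Preorder Q] [Preorder R] {C : SSet.{w}}

/-- The simplex of the nerve of a preorder given by a monotone map. -/
def simplex {n : SimplexCategoryᵒᵖ} (s : Fin (n.unop.len + 1) →o P) :
    (SSet.uliftFunctor.{w, 0}.obj (nerve P)).obj n :=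
  ⟨s.monotone.functor⟩

/-- The monotone map underlying a simplex of the nerve of a preorder. -/
def toHom {n : SimplexCategoryᵒᵖ} (x : (SSet.uliftFunctor.{w, 0}.obj (nerve P)).obj n) :
    Fin (n.unop.len + 1) →o P :=
  (show ComposableArrows P n.unop.len from x.down).toOrderHom

lemma simplex_injective {n : SimplexCategoryᵒᵖ} :
    Function.Injective (simplex.{w} (P := P) (n := n)) :=
  fun _ _ h ↦ congrArg toHom h

/-- The value of a diagram on the simplex given by a monotone map. -/
def ev (τ : Diag P C) {n : SimplexCategoryᵒᵖ} (s : Fin (n.unop.len + 1) →o P) : C.obj n :=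
  τ.app n (simplex s)

lemma ev_restr (f : P →o Q) (τ : Diag Q C) {n : SimplexCategoryᵒᵖ}
    (s : Fin (n.unop.len + 1) →o P) : (τ.restr f).ev s = τ.ev (f.comp s) := rfl

lemma map_ev (τ : Diag P C) {n m : SimplexCategoryᵒᵖ} (θ : n ⟶ m)
    (s : Fin (n.unop.len + 1) →o P) : C.map θ (τ.ev s) = τ.ev (s.comp θ.unop.toOrderHom) :=
  (ConcreteCategory.congr_hom (τ.naturality θ) (simplex s)).symm

lemma ext_ev {τ τ' : Diag P C}
    (h : ∀ (n : SimplexCategoryᵒᵖ) (s : Fin (n.unop.len + 1) →o P), τ.ev s = τ'.ev s) :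
    τ = τ' :=
  NatTrans.ext (funext fun n ↦ ConcreteCategory.hom_ext _ _ fun x ↦ h n (toHom x))

set_option linter.unusedVariables false in
/-- A diagram indexed by a preorder, from its values on simplices. -/
def ofEv (φ : ∀ {n : SimplexCategoryᵒᵖ} (_ : Fin (n.unop.len + 1) →o P), C.obj n)
    (h : ∀ {n m : SimplexCategoryᵒᵖ} (θ : n ⟶ m) (s : Fin (n.unop.len + 1) →o P),
      C.map θ (φ s) = φ (s.comp θ.unop.toOrderHom)) : Diag P C where
  app n := ↾ fun x ↦ φ (toHom x)
  naturality _ _ θ := ConcreteCategory.hom_ext _ _ fun x ↦ (h θ (toHom x)).symm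

/-! ### Gluing -/

/-- A map on a subcomplex of the nerve of a preorder can be constructed from a functional relation
which is compatible with the simplicial structure. -/
lemma exists_hom_of_rel (A : (SSet.uliftFunctor.{w, 0}.obj (nerve Q)).Subcomplex)
    (V : ∀ (n : SimplexCategoryᵒᵖ), (Fin (n.unop.len + 1) →o Q) → C.obj n → Prop)
    (hex : ∀ (n : SimplexCategoryᵒᵖ) (s : Fin (n.unop.len + 1) →o Q),
      simplex s ∈ A.obj n → ∃ c, V n s c)
    (huniq : ∀ (n : SimplexCategoryᵒᵖ) (s : Fin (n.unop.len + 1) →o Q) (c c' : C.obj n),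
      V n s c → V n s c' → c = c')
    (hmap : ∀ (n m : SimplexCategoryᵒᵖ) (θ : n ⟶ m) (s : Fin (n.unop.len + 1) →o Q) (c : C.obj n),
      V n s c → V m (s.comp θ.unop.toOrderHom) (C.map θ c)) :
    ∃ φ : (A : SSet.{w}) ⟶ C, ∀ (n : SimplexCategoryᵒᵖ) (s : Fin (n.unop.len + 1) →o Q)
      (hs : simplex s ∈ A.obj n) (c : C.obj n), V n s c → φ.app n ⟨simplex s, hs⟩ = c := by
  have key (n : SimplexCategoryᵒᵖ) (x : A.obj n) : ∃ c : C.obj n, V n (toHom x.1) c :=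
    hex n (toHom x.1) x.2
  choose c hc using key
  refine ⟨{ app n := ↾ fun x ↦ c n x, naturality := ?_ }, fun n s hs c' h ↦
    huniq n s _ _ (hc n ⟨simplex s, hs⟩) h⟩
  intro n m θ
  refine ConcreteCategory.hom_ext _ _ fun x ↦ ?_
  -- Both sides are related by `V` to the same simplex, so uniqueness makes the arbitrary choices
  -- `c` natural.
  exact huniq m _ _ _ (hc m _) (hmap n m θ _ _ (hc n x))

lemma exists_of_rel
    (V : ∀ (n : SimplexCategoryᵒᵖ), (Fin (n.unop.len + 1) →o Q) → C.obj n → Prop)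
    (hex : ∀ (n : SimplexCategoryᵒᵖ) (s : Fin (n.unop.len + 1) →o Q), ∃ c, V n s c)
    (huniq : ∀ (n : SimplexCategoryᵒᵖ) (s : Fin (n.unop.len + 1) →o Q) (c c' : C.obj n),
      V n s c → V n s c' → c = c')
    (hmap : ∀ (n m : SimplexCategoryᵒᵖ) (θ : n ⟶ m) (s : Fin (n.unop.len + 1) →o Q) (c : C.obj n),
      V n s c → V m (s.comp θ.unop.toOrderHom) (C.map θ c)) :
    ∃ ψ : Diag Q C, ∀ (n : SimplexCategoryᵒᵖ) (s : Fin (n.unop.len + 1) →o Q)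
      (c : C.obj n), V n s c → ψ.ev s = c := by
  choose c hc using hex
  exact ⟨ofEv (fun {n} s ↦ c n s) (fun {n m} θ s ↦ huniq m _ _ _ (hmap n m θ _ _ (hc n s)) (hc m _)),
    fun n s c' h ↦ huniq n s _ _ (hc n s) h⟩

end Diag

/-! ### An extension lemma for nerves of partial orders -/

section Toggle

open Diag SSet

variable {Q : Type} [PartialOrder Q]

lemma simplex_mem_nonDegenerate_iff {n : ℕ} (s : Fin (n + 1) →o Q) :
    simplex.{w} (n := op ⦋n⦌) s ∈ (SSet.uliftFunctor.{w, 0}.obj (nerve Q)).nonDegenerate n ↔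
      StrictMono s := by
  refine Iff.trans ?_
    (PartialOrder.mem_nerve_nonDegenerate_iff_strictMono (X := Q)
      (show (nerve Q) _⦋n⦌ from s.monotone.functor))
  rw [mem_nonDegenerate_iff_notMem_degenerate, mem_nonDegenerate_iff_notMem_degenerate,
    not_iff_not, mem_degenerate_iff, mem_degenerate_iff]
  refine exists_congr fun m ↦ exists_congr fun _ ↦ exists_congr fun f ↦ exists_congr fun _ ↦ ?_
  constructor
  · rintro ⟨x, hx⟩
    exact ⟨x.down, congrArg ULift.down hx⟩
  · rintro ⟨x, hx⟩
    exact ⟨⟨x⟩, congrArg ULift.up hx⟩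

/-- A strictly increasing chain is injective on vertices, and simplices of a nerve are determined by
their vertices. -/
instance : (SSet.uliftFunctor.{w, 0}.obj (nerve Q)).Nonsingular where
  mono := by
    intro n ⟨x, hx⟩
    replace hx : StrictMono (toHom x) := (simplex_mem_nonDegenerate_iff.{w} _).1 hx
    simp only [NatTrans.mono_iff_mono_app, mono_iff_injective]
    intro ⟨⟨k⟩⟩ i j hij
    ext l : 1
    exact hx.injective (DFunLike.congr_fun (congrArg toHom hij) l)

lemma strictMono_ext_range {n m : ℕ} {s : Fin n →o Q} {t : Fin m →o Q} (hs : StrictMono s)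
    (ht : StrictMono t) (h : Set.range s = Set.range t) : ∃ e : n = m, s = t.comp (Fin.castOrderIso e) := by
  have e : n = m := by
    have h₁ := Set.ncard_range_of_injective hs.injective
    have h₂ := Set.ncard_range_of_injective ht.injective
    rw [h, h₂] at h₁
    simpa using h₁.symm
  subst e
  exact ⟨rfl, OrderHom.ext _ _ ((hs.range_inj ht).1 h)⟩

lemma sMk_simplex_inj {n m : ℕ} {s : Fin (n + 1) →o Q} {t : Fin (m + 1) →o Q} (hs : StrictMono s)
    (ht : StrictMono t) : S.mk (simplex.{w} (n := op ⦋n⦌) s) = S.mk (simplex.{w} (n := op ⦋m⦌) t) ↔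
      Set.range s = Set.range t := by
  constructor
  · intro h
    have hd : n = m := congrArg S.dim h
    subst hd
    rw [S.ext_iff] at h
    rw [simplex_injective h]
  · intro h
    obtain ⟨e, rfl⟩ := strictMono_ext_range hs ht h
    obtain rfl : n = m := by omega
    rfl

/-- Inverse to deleting `v` from a chain: an element comparable to the whole chain and with members
of it on both sides fits into exactly one gap. -/
lemma strictMono_of_comp_mem {n : ℕ} {s : Fin (n + 1) →o Q} {v : Q} (hs : StrictMono s)
    (hv : ∀ q ∈ Set.range s, q ≤ v ∨ v ≤ q) (h₁ : ∃ q ∈ Set.range s, q < v)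
    (h₂ : ∃ q ∈ Set.range s, v < q) (hv' : v ∉ Set.range s) :
    ∃ (t : Fin (n + 2) →o Q) (i : Fin (n + 2)), StrictMono t ∧ t i = v ∧
      t.comp (Fin.succAboveOrderEmb i).toOrderHom = s := by
  -- The gap is where the chain stops being below `v`; without one, induction from the bottom would
  -- put the whole chain below `v`.
  obtain ⟨i, hi, hi'⟩ : ∃ i : Fin n, s i.castSucc < v ∧ ¬ s i.succ < v := by
    by_contra! h
    obtain ⟨_, ⟨j, rfl⟩, hj⟩ := h₁
    obtain ⟨_, ⟨j', rfl⟩, hj'⟩ := h₂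
    have (k : Fin (n + 1)) : s k < v := by
      induction k using Fin.induction with
      | zero => exact (s.monotone (Fin.zero_le j)).trans_lt hj
      | succ k hk => exact h k hk
    exact lt_asymm hj' (this j')
  have hi'' : v < s i.succ := by
    refine lt_of_le_of_ne ?_ (fun h ↦ hv' ⟨_, h.symm⟩)
    refine (hv _ ⟨i.succ, rfl⟩).resolve_left fun h ↦ ?_
    exact hi' (lt_of_le_of_ne h fun h ↦ hv' ⟨_, h⟩)
  have ht := Fin.strictMono_insertNth hs i v hi hi''
  refine ⟨⟨_, ht.monotone⟩, i.castSucc.succ, ht, ?_, ?_⟩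
  · exact Fin.insertNth_apply_same (α := fun _ ↦ Q) _ _ _
  · ext j
    exact Fin.insertNth_apply_succAbove (α := fun _ ↦ Q) _ _ _ _

lemma range_comp_succAbove {n : ℕ} {t : Fin (n + 2) →o Q} (ht : StrictMono t) (i : Fin (n + 2)) :
    Set.range (t.comp (Fin.succAboveOrderEmb i).toOrderHom) = Set.range t \ {t i} := by
  ext q
  constructor
  · rintro ⟨j, rfl⟩
    exact ⟨⟨_, rfl⟩, fun h ↦ Fin.succAbove_ne i j (ht.injective h)⟩
  · rintro ⟨⟨j, rfl⟩, hj⟩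
    obtain ⟨k, rfl⟩ := Fin.exists_succAbove_eq (show j ≠ i from fun h ↦ hj congr(t $h))
    exact ⟨k, rfl⟩

variable (A : (SSet.uliftFunctor.{w, 0}.obj (nerve Q)).Subcomplex) (v : Q)

/-- The nondegenerate simplices not in `A` with vertex `v`. -/
structure ToggleIndex where
  /-- the dimension is one more -/
  dim : ℕ
  /-- the chain -/
  chain : Fin (dim + 2) →o Q
  strictMono : StrictMono chain
  /-- the position of `v` -/
  index : Fin (dim + 2)
  chain_index : chain index = v
  notMem : simplex (n := op ⦋dim + 1⦌) chain ∉ A.obj _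

variable {A v}

lemma ToggleIndex.ext_range {x y : ToggleIndex A v} (h : Set.range x.chain = Set.range y.chain) :
    x = y := by
  obtain ⟨n, s, hs, i, hi, hs'⟩ := x
  obtain ⟨m, t, ht, j, hj, ht'⟩ := y
  obtain ⟨e, h⟩ := strictMono_ext_range hs ht h
  obtain rfl : n = m := by omega
  obtain rfl : s = t := h
  obtain rfl : i = j := hs.injective (hi.trans hj.symm)
  rfl

lemma ToggleIndex.ext_range_diff {x y : ToggleIndex A v}
    (h : Set.range x.chain \ {v} = Set.range y.chain \ {v}) : x = y := by
  refine ext_range ?_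
  have hx : v ∈ Set.range x.chain := ⟨_, x.chain_index⟩
  have hy : v ∈ Set.range y.chain := ⟨_, y.chain_index⟩
  rw [← Set.insert_sdiff_self_of_mem hx, ← Set.insert_sdiff_self_of_mem hy, h]

lemma ToggleIndex.range_face (x : ToggleIndex A v) :
    Set.range (x.chain.comp (Fin.succAboveOrderEmb x.index).toOrderHom) =
      Set.range x.chain \ {v} := by
  rw [range_comp_succAbove x.strictMono, x.chain_index]

lemma ToggleIndex.strictMono_face (x : ToggleIndex A v) :
    StrictMono (x.chain.comp (Fin.succAboveOrderEmb x.index).toOrderHom) :=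
  x.strictMono.comp (Fin.strictMono_succAbove _)

/-- The face avoids `v`, so it lies in the face of `y` opposite to `v`; these have equally many
vertices and hence coincide. This is what makes the pairing regular. -/
lemma ToggleIndex.ext_of_face_subset {x y : ToggleIndex A v} (hd : x.dim = y.dim)
    (h : Set.range (x.chain.comp (Fin.succAboveOrderEmb x.index).toOrderHom) ⊆
      Set.range y.chain) : x = y := by
  refine ext_range_diff ?_
  rw [← range_face, ← range_face]
  refine Set.eq_of_subset_of_ncard_le ?_ ?_ (Set.finite_range _)
  · rw [range_face y]
    exact fun q hq ↦ ⟨h hq, (x.range_face.le hq).2⟩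
  · rw [Set.ncard_range_of_injective x.strictMono_face.injective,
      Set.ncard_range_of_injective y.strictMono_face.injective, hd]

/-- The condition that all nondegenerate simplices outside of a subcomplex come in pairs
`s`, `s ∪ {v}`, where `v` is an inner vertex of `s ∪ {v}`. -/
structure IsToggle (A : (SSet.uliftFunctor.{w, 0}.obj (nerve Q)).Subcomplex) (v : Q) : Prop where
  comparable ⦃n : ℕ⦄ (s : Fin (n + 1) →o Q) (hs : simplex (n := op ⦋n⦌) s ∉ A.obj _) :
    ∀ q ∈ Set.range s, q ≤ v ∨ v ≤ q
  exists_lt ⦃n : ℕ⦄ (s : Fin (n + 1) →o Q) (hs : simplex (n := op ⦋n⦌) s ∉ A.obj _) :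
    ∃ q ∈ Set.range s, q < v
  exists_gt ⦃n : ℕ⦄ (s : Fin (n + 1) →o Q) (hs : simplex (n := op ⦋n⦌) s ∉ A.obj _) :
    ∃ q ∈ Set.range s, v < q
  notMem_of_diff ⦃n m : ℕ⦄ (s : Fin (n + 1) →o Q) (hs : simplex (n := op ⦋n⦌) s ∉ A.obj _)
    (t : Fin (m + 1) →o Q) (ht : Set.range t = Set.range s \ {v}) :
    simplex (n := op ⦋m⦌) t ∉ A.obj _

namespace IsToggle

variable (h : IsToggle A v)

/-- The pairing given by a toggle. -/
def pairingCore : A.PairingCore where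
  ι := ToggleIndex A v
  dim x := x.dim
  simplex x := simplex (n := op ⦋x.dim + 1⦌) x.chain
  index x := x.index
  nonDegenerate₁ x := (simplex_mem_nonDegenerate_iff.{w} x.chain).2 x.strictMono
  nonDegenerate₂ x := (simplex_mem_nonDegenerate_iff.{w} _).2 x.strictMono_face
  notMem₁ x := x.notMem
  notMem₂ x := h.notMem_of_diff x.chain x.notMem _ x.range_face
  injective_type₁' {x y} e := ToggleIndex.ext_range
    ((sMk_simplex_inj.{w} x.strictMono y.strictMono).1 e)
  injective_type₂' {x y} e := by
    refine ToggleIndex.ext_range_diff ?_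
    rw [← x.range_face, ← y.range_face]
    exact (sMk_simplex_inj.{w} x.strictMono_face y.strictMono_face).1 e
  type₁_ne_type₂' x y e := by
    have := (sMk_simplex_inj.{w} x.strictMono y.strictMono_face).1 e
    rw [y.range_face] at this
    exact (this.le ⟨_, x.chain_index⟩).2 rfl
  surjective' x := by
    obtain ⟨n, x, hx, hx', rfl⟩ := x.mk_surjective
    obtain ⟨s, rfl⟩ : ∃ s : Fin (n + 1) →o Q, x = simplex s := ⟨toHom x, rfl⟩
    have hs := (simplex_mem_nonDegenerate_iff.{w} s).1 hx
    -- Simplices containing `v` are of the first type. The others are of the second type, with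
    -- partner obtained by inserting `v`; the partner avoids `A` because `A` is closed under faces.
    -- Dimension `0` is impossible in the first case, as some vertex is below `v`.
    by_cases hv : v ∈ Set.range s
    · obtain ⟨i, hi⟩ := hv
      obtain _ | n := n
      · obtain ⟨_, ⟨j, rfl⟩, hj⟩ := h.exists_lt s hx'
        rw [← hi, show j = i from Subsingleton.elim (α := Fin 1) j i] at hj
        exact (lt_irrefl _ hj).elim
      · exact ⟨⟨n, s, hs, i, hi, hx'⟩, Or.inl rfl⟩
    · obtain ⟨t, i, ht, hi, rfl⟩ := strictMono_of_comp_mem hs (h.comparable s hx')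
        (h.exists_lt s hx') (h.exists_gt s hx') hv
      exact ⟨⟨n, t, ht, i, hi, fun ht' ↦ hx' (A.map (SimplexCategory.δ i).op ht')⟩, Or.inr rfl⟩

include h in
lemma index_ne_zero (x : ToggleIndex A v) : x.index ≠ 0 := by
  intro e
  obtain ⟨_, ⟨j, rfl⟩, hj⟩ := h.exists_lt x.chain x.notMem
  have := x.strictMono.lt_iff_lt.1 (hj.trans_eq x.chain_index.symm)
  rw [e] at this
  exact Fin.not_lt_zero _ this

include h in
lemma index_ne_last (x : ToggleIndex A v) : x.index ≠ Fin.last _ := by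
  intro e
  obtain ⟨_, ⟨j, rfl⟩, hj⟩ := h.exists_gt x.chain x.notMem
  have := x.strictMono.lt_iff_lt.1 (x.chain_index.trans_lt hj)
  rw [e] at this
  exact absurd this (not_lt.2 (Fin.le_last _))

instance : h.pairingCore.IsInner where
  ne_zero := h.index_ne_zero
  ne_last := h.index_ne_last

/-- A constant rank function suffices: by `ToggleIndex.ext_of_face_subset`, no two distinct pairs of
the same dimension are related by the order in which horns must be filled. -/
instance : h.pairingCore.IsRegular := by
  let f : h.pairingCore.WeakRankFunction ℕ :=
    { rank _ := 0
      lt := by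
        intro x y hxy hd
        exfalso
        have h₁ := hxy.2.le
        rw [Subcomplex.N.le_iff, SSet.N.le_iff, Subcomplex.ofSimplex_le_iff] at h₁
        obtain ⟨f, hf⟩ := h₁
        refine hxy.1 (ToggleIndex.ext_of_face_subset (x := x) (y := y) hd ?_)
        rintro _ ⟨i, rfl⟩
        exact ⟨f.unop.toOrderHom i, DFunLike.congr_fun (congrArg toHom hf) i⟩ }
  exact f.isRegular

end IsToggle

/-- If `A` is a subcomplex of the nerve of a partial order with a toggle, then maps from `A` to
a quasi-category can be extended. -/
lemma IsToggle.exists_extension (h : IsToggle A v) {C : SSet.{w}} [Quasicategory C]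
    (φ : (A : SSet.{w}) ⟶ C) : ∃ ψ : Diag Q C, A.ι ≫ ψ = φ := by
  -- A regular inner pairing makes the inclusion of `A` inner anodyne, so it lifts against the inner
  -- fibration from `C` to the point.
  have h₁ := h.pairingCore.pairing.innerAnodyneExtensions
  have : InnerFibration (Limits.terminal.from C) := inferInstance
  have := h₁ _ (mem_innerFibrations (Limits.terminal.from C))
  have sq : CommSq φ A.ι (Limits.terminal.from C) (Limits.terminal.from _) := ⟨by simp⟩
  have := this.sq_hasLift sq
  exact ⟨sq.lift, sq.fac_left⟩

end Toggle

/-! ### Simplices of joins -/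

namespace Diag

section Factor

variable {B : Type} [Preorder B] {l k : ℕ}

lemma lexSumMap_inl {α α' β β' : Type} [Preorder α] [Preorder α'] [Preorder β] [Preorder β']
    (f : α →o α') (g : β →o β') (a : α) : lexSumMap f g (Sum.inlₗ a) = Sum.inlₗ (f a) := rfl

lemma lexSum_cases {α β : Type} (x : α ⊕ₗ β) : (∃ a, x = Sum.inlₗ a) ∨ ∃ b, x = Sum.inrₗ b := by
  rcases x with a | b
  · exact Or.inl ⟨a, rfl⟩
  · exact Or.inr ⟨b, rfl⟩

/-- `c` is the last element which a monotone map to an ordinal sum sends to the left summand. -/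
def IsLastLeft (s : Fin (l + 1) →o (Fin (k + 1) ⊕ₗ B)) (c : Fin (l + 1)) : Prop :=
  ∀ x, (ofLex (s x)).isLeft = true ↔ x ≤ c

/-- By monotonicity the positions sent to the left summand form an initial segment; either it is
empty or it has a last element. -/
lemma exists_isLastLeft (s : Fin (l + 1) →o (Fin (k + 1) ⊕ₗ B)) :
    (∃ t : Fin (l + 1) →o B, s = (lexSumInr _ _).comp t) ∨ ∃ c, IsLastLeft s c := by
  classical
  by_cases h : ∃ x, (ofLex (s x)).isLeft = true
  · right
    have hne : (Finset.univ.filter fun x ↦ (ofLex (s x)).isLeft = true).Nonempty := by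
      obtain ⟨x, hx⟩ := h
      exact ⟨x, by simpa using hx⟩
    refine ⟨Finset.max' _ hne, fun x ↦ ⟨fun hx ↦ Finset.le_max' _ _ (by simpa using hx),
      fun hx ↦ ?_⟩⟩
    have h₁ := Finset.max'_mem _ hne
    rw [Finset.mem_filter] at h₁
    have h₂ := s.monotone hx
    obtain ⟨a, ha⟩ | ⟨b, hb⟩ := lexSum_cases (s x)
    · rw [ha]; rfl
    · obtain ⟨a', ha'⟩ | ⟨b', hb'⟩ := lexSum_cases (s (Finset.max' _ hne))
      · rw [hb, ha'] at h₂
        exact absurd h₂ Sum.Lex.not_inr_le_inl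
      · rw [hb'] at h₁
        exact absurd h₁.2 (by simp [Sum.inrₗ])
  · left
    push Not at h
    have this (x : Fin (l + 1)) : ∃ b, s x = Sum.inrₗ b := by
      obtain ⟨a, ha⟩ | h' := lexSum_cases (s x)
      · exact absurd (h x) (by rw [ha]; simp [Sum.inlₗ])
      · exact h'
    choose t ht using this
    refine ⟨⟨t, fun x y hxy ↦ ?_⟩, OrderHom.ext _ _ (funext ht)⟩
    have := s.monotone hxy
    rw [ht, ht] at this
    exact Sum.Lex.inr_le_inr_iff.1 this

/-- The component in the left summand of a monotone map to an ordinal sum, extended constantly. -/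
def leftPart (s : Fin (l + 1) →o (Fin (k + 1) ⊕ₗ B)) {c : Fin (l + 1)} (hc : IsLastLeft s c) :
    Fin (l + 1) →o Fin (k + 1) where
  -- The value `0` is never taken from the right summand, since position `min x c` is always sent to
  -- the left.
  toFun x := Sum.elim id (fun _ ↦ 0) (ofLex (s (min x c)))
  monotone' x y hxy := by
    dsimp only
    have h₁ := (hc (min x c)).2 (min_le_right _ _)
    have h₂ := (hc (min y c)).2 (min_le_right _ _)
    have h₃ := s.monotone (min_le_min_right c hxy)
    obtain ⟨a, ha⟩ | ⟨b, hb⟩ := lexSum_cases (s (min x c))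
    · obtain ⟨a', ha'⟩ | ⟨b', hb'⟩ := lexSum_cases (s (min y c))
      · rw [ha, ha'] at h₃ ⊢
        exact Sum.Lex.inl_le_inl_iff.1 h₃
      · rw [hb'] at h₂
        exact absurd h₂ (by simp [Sum.inrₗ])
    · rw [hb] at h₁
      exact absurd h₁ (by simp [Sum.inrₗ])

/-- A monotone map to an ordinal sum, with the component in the left summand replaced by the
identity. -/
def standardize (s : Fin (l + 1) →o (Fin (k + 1) ⊕ₗ B)) : Fin (l + 1) →o (Fin (l + 1) ⊕ₗ B) where
  toFun x := Sum.elim (fun _ ↦ Sum.inlₗ x) Sum.inrₗ (ofLex (s x))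
  monotone' x y hxy := by
    have h := s.monotone hxy
    dsimp only
    obtain ⟨a, ha⟩ | ⟨b, hb⟩ := lexSum_cases (s x) <;>
    obtain ⟨a', ha'⟩ | ⟨b', hb'⟩ := lexSum_cases (s y)
    · rw [ha, ha']
      exact Sum.Lex.inl_le_inl_iff.2 hxy
    · rw [ha, hb']
      exact Sum.Lex.inl_le_inr _ _
    · rw [hb, ha'] at h
      exact absurd h Sum.Lex.not_inr_le_inl
    · rw [hb, hb'] at h
      rw [hb, hb']
      exact Sum.Lex.inr_le_inr_iff.2 (Sum.Lex.inr_le_inr_iff.1 h)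

/-- The canonical form of a simplex of `Δᵏ ⋆ N(B)` that meets `Δᵏ`: it comes from a simplex of `Δˡ ⋆
N(B)` of the same dimension `l`, along an operator `[l] → [k]`. A map into a slice is thus evaluated
on it through a single `l`-simplex of its source. -/
lemma leftPart_comp_standardize (s : Fin (l + 1) →o (Fin (k + 1) ⊕ₗ B)) {c : Fin (l + 1)}
    (hc : IsLastLeft s c) : (lexSumMap (leftPart s hc) OrderHom.id).comp (standardize s) = s := by
  ext x : 2
  obtain ⟨a, ha⟩ | ⟨b, hb⟩ := lexSum_cases (s x)
  · have : x ≤ c := (hc x).1 (by rw [ha]; rfl)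
    have h₁ : standardize s x = Sum.inlₗ x := by
      change Sum.elim _ _ (ofLex (s x)) = _
      rw [ha]; rfl
    change lexSumMap _ _ (standardize s x) = _
    rw [h₁, ha, lexSumMap_inl]
    congr 1
    change Sum.elim _ _ (ofLex (s (min x c))) = _
    rw [min_eq_left this, ha]
    rfl
  · have h₁ : standardize s x = Sum.inrₗ b := by
      change Sum.elim _ _ (ofLex (s x)) = _
      rw [hb]; rfl
    change lexSumMap _ _ (standardize s x) = _
    rw [h₁, hb]
    rfl

/-- Extending by the last left value creates no new vertices, so `leftPart s` lies in the boundary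
as soon as `s` misses a vertex of the simplex. -/
lemma leftPart_mem_range (s : Fin (l + 1) →o (Fin (k + 1) ⊕ₗ B)) {c : Fin (l + 1)}
    (hc : IsLastLeft s c) (x : Fin (l + 1)) :
    Sum.inlₗ (leftPart s hc x) ∈ Set.range s := by
  refine ⟨min x c, ?_⟩
  have h₁ := (hc (min x c)).2 (min_le_right _ _)
  obtain ⟨a, ha⟩ | ⟨b, hb⟩ := lexSum_cases (s (min x c))
  · rw [ha]
    change _ = Sum.inlₗ (Sum.elim _ _ (ofLex (s (min x c))))
    rw [ha]
    rfl
  · rw [hb] at h₁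
    exact absurd h₁ (by simp [Sum.inrₗ])

variable {B' : Type} [Preorder B'] {m : ℕ}

lemma IsLastLeft.map {s : Fin (l + 1) →o (Fin (k + 1) ⊕ₗ B)} {c : Fin (l + 1)}
    (hc : IsLastLeft s c) (t : Fin (k + 1) →o Fin (m + 1)) (f : B →o B') :
    IsLastLeft ((lexSumMap t f).comp s) c := by
  intro x
  rw [← hc x]
  change (ofLex (lexSumMap t f (s x))).isLeft = true ↔ _
  obtain ⟨a, ha⟩ | ⟨b, hb⟩ := lexSum_cases (s x)
  · rw [ha]; rfl
  · rw [hb]; rfl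

lemma IsLastLeft.of_map {s : Fin (l + 1) →o (Fin (k + 1) ⊕ₗ B)} {c : Fin (l + 1)}
    {t : Fin (k + 1) →o Fin (m + 1)} {f : B →o B'}
    (hc : IsLastLeft ((lexSumMap t f).comp s) c) : IsLastLeft s c := by
  intro x
  rw [← hc x]
  change _ ↔ (ofLex (lexSumMap t f (s x))).isLeft = true
  obtain ⟨a, ha⟩ | ⟨b, hb⟩ := lexSum_cases (s x)
  · rw [ha]; rfl
  · rw [hb]; rfl

lemma leftPart_map {s : Fin (l + 1) →o (Fin (k + 1) ⊕ₗ B)} {c : Fin (l + 1)}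
    (hc : IsLastLeft s c) (t : Fin (k + 1) →o Fin (m + 1)) (f : B →o B') :
    leftPart ((lexSumMap t f).comp s) (hc.map t f) = t.comp (leftPart s hc) := by
  ext x : 2
  change Sum.elim _ _ (ofLex (lexSumMap t f (s (min x c)))) = t (Sum.elim _ _ (ofLex (s (min x c))))
  have h₁ := (hc (min x c)).2 (min_le_right _ _)
  obtain ⟨a, ha⟩ | ⟨b, hb⟩ := lexSum_cases (s (min x c))
  · rw [ha]; rfl
  · rw [hb] at h₁
    exact absurd h₁ (by simp [Sum.inrₗ])

/-- Standardization forgets the values in the left summand, so `t` leaves no trace. -/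
lemma standardize_map (s : Fin (l + 1) →o (Fin (k + 1) ⊕ₗ B)) (t : Fin (k + 1) →o Fin (m + 1))
    (f : B →o B') : standardize ((lexSumMap t f).comp s) =
      (lexSumMap OrderHom.id f).comp (standardize s) := by
  ext x : 2
  change Sum.elim _ _ (ofLex (lexSumMap t f (s x))) =
    lexSumMap OrderHom.id f (Sum.elim _ _ (ofLex (s x)))
  obtain ⟨a, ha⟩ | ⟨b, hb⟩ := lexSum_cases (s x)
  · rw [ha]; rfl
  · rw [hb]; rfl

end Factor

end Diag

namespace Diag

lemma lexSumMap_comp {α α' α'' β β' β'' : Type} [Preorder α] [Preorder α'] [Preorder α'']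
    [Preorder β] [Preorder β'] [Preorder β''] (f : α →o α') (g : β →o β') (f' : α' →o α'')
    (g' : β' →o β'') :
    (lexSumMap f' g').comp (lexSumMap f g) = lexSumMap (f'.comp f) (g'.comp g) := by
  ext x : 2
  obtain ⟨a, rfl⟩ | ⟨b, rfl⟩ := lexSum_cases x <;> rfl

lemma lexSumMap_id {α β : Type} [Preorder α] [Preorder β] :
    lexSumMap (OrderHom.id (α := α)) (OrderHom.id (α := β)) = OrderHom.id := by
  ext x : 2
  obtain ⟨a, rfl⟩ | ⟨b, rfl⟩ := lexSum_cases x <;> rfl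

lemma lexSumMap_le_iff {α α' β β' : Type} [Preorder α] [Preorder α']
    [Preorder β] [Preorder β'] {f : α →o α'} {g : β →o β'} (hf : ∀ a b, f a ≤ f b ↔ a ≤ b)
    (hg : ∀ a b, g a ≤ g b ↔ a ≤ b) (x y : α ⊕ₗ β) :
    lexSumMap f g x ≤ lexSumMap f g y ↔ x ≤ y := by
  obtain ⟨a, rfl⟩ | ⟨a, rfl⟩ := lexSum_cases x <;>
  obtain ⟨b, rfl⟩ | ⟨b, rfl⟩ := lexSum_cases y
  · exact Sum.Lex.inl_le_inl_iff.trans ((hf a b).trans Sum.Lex.inl_le_inl_iff.symm)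
  · exact ⟨fun _ ↦ Sum.Lex.inl_le_inr _ _, fun _ ↦ Sum.Lex.inl_le_inr _ _⟩
  · exact ⟨fun h ↦ (Sum.Lex.not_inr_le_inl h).elim, fun h ↦ (Sum.Lex.not_inr_le_inl h).elim⟩
  · exact Sum.Lex.inr_le_inr_iff.trans ((hg a b).trans Sum.Lex.inr_le_inr_iff.symm)

lemma exists_comp_eq_of_range_subset {l : ℕ} {R Q : Type} [Preorder R] [Preorder Q] {g : R →o Q}
    (hg : ∀ a b, g a ≤ g b ↔ a ≤ b) (s : Fin (l + 1) →o Q) (hs : Set.range s ⊆ Set.range g) :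
    ∃ t : Fin (l + 1) →o R, s = g.comp t := by
  choose t ht using fun x ↦ hs ⟨x, rfl⟩
  exact ⟨⟨t, fun x y h ↦ (hg _ _).1 (by rw [ht, ht]; exact s.monotone h)⟩,
    OrderHom.ext _ _ (funext fun x ↦ (ht x).symm)⟩

lemma comp_injective_of_le_iff {l : ℕ} {R Q : Type} [PartialOrder R] [Preorder Q] {g : R →o Q}
    (hg : ∀ a b, g a ≤ g b ↔ a ≤ b) {s t : Fin (l + 1) →o R} (h : g.comp s = g.comp t) :
    s = t := by
  have h' (x) : g (s x) = g (t x) := DFunLike.congr_fun h x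
  exact OrderHom.ext _ _ (funext fun x ↦
    le_antisymm ((hg _ _).1 (h' x).le) ((hg _ _).1 (h' x).ge))

lemma exists_of_lexSumMap_comp_eq_inr {k l m : ℕ} {B B' : Type} [Preorder B] [Preorder B']
    {t : Fin (k + 1) →o Fin (m + 1)} {f : B →o B'} {s : Fin (l + 1) →o Fin (k + 1) ⊕ₗ B}
    {s' : Fin (l + 1) →o B'} (h : (lexSumMap t f).comp s = (lexSumInr _ _).comp s') :
    ∃ s'' : Fin (l + 1) →o B, s = (lexSumInr _ _).comp s'' ∧ s' = f.comp s'' := by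
  obtain ⟨s'', rfl⟩ | ⟨c, hc⟩ := exists_isLastLeft s
  · exact ⟨s'', rfl, OrderHom.ext _ _ (funext fun x ↦
      (Sum.inr_injective (DFunLike.congr_fun h x)).symm)⟩
  · have := (hc.map t f c).2 le_rfl
    rw [h] at this
    cases this

end Diag

/-! ### Restriction functors between slices -/

section SliceMap

open Diag SSet

variable {A B : Type} [PartialOrder A] [PartialOrder B] {C : SSet.{w}}
  (f : A →o B) (p : Diag B C)

/-- The restriction map `C_{/p} ⟶ C_{/pf}` between slices. -/
def sliceOverMap : sliceOver p ⟶ sliceOver (p.restr f) where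
  app n := ↾ fun τ ↦ ⟨τ.1.restr (lexSumMap OrderHom.id f), congrArg (restr f) τ.2⟩
  naturality n n' θ := ConcreteCategory.hom_ext _ _ fun τ ↦ Subtype.ext (by
    change (τ.1.restr _).restr _ = (τ.1.restr _).restr _
    rw [restr_restr, restr_restr, lexSumMap_comp, lexSumMap_comp]
    rfl)

variable (m : ℕ)

/-- The subcomplex `Δᵐ ⋆ N(A) ∪ ∂Δᵐ ⋆ N(B)` of `Δᵐ ⋆ N(B)`. -/
def boundaryJoin : (SSet.uliftFunctor.{w, 0}.obj (nerve (Fin (m + 1) ⊕ₗ B))).Subcomplex where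
  obj n := {x | Set.range (toHom x) ⊆ Set.range (lexSumMap (OrderHom.id (α := Fin (m + 1))) f) ∨
    ∃ i : Fin (m + 1), Sum.inlₗ i ∉ Set.range (toHom x)}
  map {n n'} θ := by
    intro x hx
    have : Set.range (toHom ((SSet.uliftFunctor.{w, 0}.obj
        (nerve (Fin (m + 1) ⊕ₗ B))).map θ x)) ⊆ Set.range (toHom x) := by
      rintro _ ⟨i, rfl⟩
      exact ⟨_, rfl⟩
    exact hx.imp (this.trans ·) fun ⟨i, hi⟩ ↦ ⟨i, fun h ↦ hi (this h)⟩

variable {m}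

lemma simplex_mem_boundaryJoin {n : SimplexCategoryᵒᵖ}
    (s : Fin (n.unop.len + 1) →o Fin (m + 1) ⊕ₗ B) :
    simplex s ∈ (boundaryJoin.{w} f m).obj n ↔
      Set.range s ⊆ Set.range (lexSumMap (OrderHom.id (α := Fin (m + 1))) f) ∨
        ∃ i : Fin (m + 1), Sum.inlₗ i ∉ Set.range s := Iff.rfl

lemma inr_mem_boundaryJoin {n : SimplexCategoryᵒᵖ} (s : Fin (n.unop.len + 1) →o B) :
    simplex ((lexSumInr (Fin (m + 1)) B).comp s) ∈ (boundaryJoin.{w} f m).obj n :=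
  Or.inr ⟨0, fun ⟨_, h⟩ ↦ by cases h⟩

lemma sub_mem_boundaryJoin {n : SimplexCategoryᵒᵖ} (s : Fin (n.unop.len + 1) →o Fin (m + 1) ⊕ₗ A) :
    simplex ((lexSumMap OrderHom.id f).comp s) ∈ (boundaryJoin.{w} f m).obj n :=
  Or.inl fun _ ⟨x, h⟩ ↦ ⟨s x, h⟩

lemma bdry_mem_boundaryJoin {n k : SimplexCategoryᵒᵖ} (t : (∂Δ[m] : SSet.{w}).obj k)
    (s : Fin (n.unop.len + 1) →o Fin (k.unop.len + 1) ⊕ₗ B) :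
    simplex ((lexSumMap (stdSimplex.asOrderHom t.1) OrderHom.id).comp s) ∈
      (boundaryJoin.{w} f m).obj n := by
  obtain ⟨t, ht⟩ := t
  have ht' : ¬ Function.Surjective (stdSimplex.asOrderHom t) := ht
  simp only [Function.Surjective, not_forall, not_exists] at ht'
  obtain ⟨i, hi⟩ := ht'
  refine Or.inr ⟨i, fun ⟨x, hx⟩ ↦ ?_⟩
  change lexSumMap _ _ (s x) = _ at hx
  obtain ⟨a, ha⟩ | ⟨b, hb⟩ := lexSum_cases (s x)
  · rw [ha, lexSumMap_inl] at hx
    exact hi a (Sum.inl_injective hx)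
  · rw [hb] at hx
    cases hx

variable {f p}

/-- A lifting problem of `∂Δᵐ ⊆ Δᵐ` against `C_{/p} → C_{/pf}` is the same as a map on `Δᵐ ⋆ N(A) ∪
∂Δᵐ ⋆ N(B)`: `u` and `y` prescribe the two pieces, and commutativity of the square (`huy`) is their
agreement on the overlap. -/
lemma exists_boundaryJoin_hom (hf : ∀ a b, f a ≤ f b ↔ a ≤ b)
    (u : (∂Δ[m] : SSet.{w}) ⟶ sliceOver p)
    (y : Diag (Fin (m + 1) ⊕ₗ A) C) (hy : y.restr (lexSumInr _ _) = p.restr f)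
    (huy : ∀ (k : SimplexCategoryᵒᵖ) (t : (∂Δ[m] : SSet.{w}).obj k),
      Diag.restr (lexSumMap OrderHom.id f) (u.app k t).1 =
        y.restr (lexSumMap (stdSimplex.asOrderHom t.1) OrderHom.id)) :
    ∃ φ : (boundaryJoin.{w} f m : SSet.{w}) ⟶ C,
      (∀ (n : SimplexCategoryᵒᵖ) (s : Fin (n.unop.len + 1) →o B),
        φ.app n ⟨_, inr_mem_boundaryJoin f s⟩ = p.ev s) ∧
      (∀ (n : SimplexCategoryᵒᵖ) (s : Fin (n.unop.len + 1) →o Fin (m + 1) ⊕ₗ A),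
        φ.app n ⟨_, sub_mem_boundaryJoin f s⟩ = y.ev s) ∧
      (∀ (n k : SimplexCategoryᵒᵖ) (t : (∂Δ[m] : SSet.{w}).obj k)
        (s : Fin (n.unop.len + 1) →o Fin (k.unop.len + 1) ⊕ₗ B),
        φ.app n ⟨_, bdry_mem_boundaryJoin f t s⟩ = Diag.ev (u.app k t).1 s) := by
  -- The clauses are the values on `N(B)`, on `Δᵐ ⋆ N(A)` and on `∂Δᵐ ⋆ N(B)`. The first is needed
  -- since no simplex of `∂Δᵐ` is available when `m = 0`. In the third, `t` has arbitrary dimension,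
  -- which makes stability under operators immediate and leaves the work to uniqueness.
  let V (n : SimplexCategoryᵒᵖ) (s : Fin (n.unop.len + 1) →o Fin (m + 1) ⊕ₗ B) (c : C.obj n) :
      Prop :=
    (∃ s' : Fin (n.unop.len + 1) →o B, s = (lexSumInr _ _).comp s' ∧ c = p.ev s') ∨
    (∃ s' : Fin (n.unop.len + 1) →o Fin (m + 1) ⊕ₗ A,
      s = (lexSumMap OrderHom.id f).comp s' ∧ c = y.ev s') ∨
    (∃ (k : SimplexCategoryᵒᵖ) (t : (∂Δ[m] : SSet.{w}).obj k)
      (s' : Fin (n.unop.len + 1) →o Fin (k.unop.len + 1) ⊕ₗ B),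
      s = (lexSumMap (stdSimplex.asOrderHom t.1) OrderHom.id).comp s' ∧
        c = Diag.ev (u.app k t).1 s')
  have hg := lexSumMap_le_iff (f := OrderHom.id (α := Fin (m + 1))) (fun _ _ ↦ Iff.rfl) hf
  have hu (k : SimplexCategoryᵒᵖ) (t : (∂Δ[m] : SSet.{w}).obj k) :
      Diag.restr (lexSumInr _ _) (u.app k t).1 = p := (u.app k t).2
  have hbase (n : SimplexCategoryᵒᵖ) (s : Fin (n.unop.len + 1) →o B) (c : C.obj n)
      (h : V n ((lexSumInr _ _).comp s) c) : c = p.ev s := by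
    obtain ⟨s', h, rfl⟩ | ⟨s', h, rfl⟩ | ⟨k, t, s', h, rfl⟩ := h
    · rw [show s = s' from OrderHom.ext _ _ (funext fun x ↦
        Sum.inr_injective (DFunLike.congr_fun h x))]
    · obtain ⟨s'', rfl, rfl⟩ := exists_of_lexSumMap_comp_eq_inr h.symm
      rw [← ev_restr, hy, ev_restr]
    · obtain ⟨s'', rfl, rfl⟩ := exists_of_lexSumMap_comp_eq_inr h.symm
      rw [← ev_restr, hu]
      rfl
  -- Normal form: naturality of `u` along `leftPart` moves any value of the third kind to a `t` of
  -- the same dimension `n`, evaluated at `standardize s`.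
  have hcan (n : SimplexCategoryᵒᵖ) (s : Fin (n.unop.len + 1) →o Fin (m + 1) ⊕ₗ B)
      (z : Fin (n.unop.len + 1)) (hz : IsLastLeft s z) (c : C.obj n) (h : V n s c) :
      (∃ s' : Fin (n.unop.len + 1) →o Fin (m + 1) ⊕ₗ A,
        s = (lexSumMap OrderHom.id f).comp s' ∧ c = y.ev s') ∨
      ∃ t : (∂Δ[m] : SSet.{w}).obj n, stdSimplex.asOrderHom t.1 = leftPart s hz ∧
        c = Diag.ev (u.app n t).1 (standardize s) := by
    obtain ⟨s', rfl, rfl⟩ | ⟨s', h, rfl⟩ | ⟨k, t, s', rfl, rfl⟩ := h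
    · have := (hz z).2 le_rfl
      cases this
    · exact Or.inl ⟨s', h, rfl⟩
    · right
      have hz' : IsLastLeft s' z := hz.of_map
      refine ⟨(∂Δ[m] : SSet.{w}).map (Quiver.Hom.op (V := SimplexCategory) (X := n.unop) (Y := k.unop)
          (SimplexCategory.Hom.mk (leftPart s' hz'))) t,
        (leftPart_map hz' _ _).symm, ?_⟩
      rw [standardize_map, lexSumMap_id]
      have h₁ := congrArg Subtype.val (ConcreteCategory.congr_hom
        (u.naturality (Quiver.Hom.op (V := SimplexCategory) (X := n.unop) (Y := k.unop)
          (SimplexCategory.Hom.mk (leftPart s' hz')))) t)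
      change (u.app n _).1 = Diag.restr _ (u.app k t).1 at h₁
      refine Eq.trans ?_ (congrArg (fun τ ↦ Diag.ev τ (standardize s')) h₁.symm)
      exact congrArg (Diag.ev (u.app k t).1) (leftPart_comp_standardize s' hz').symm
  refine (exists_hom_of_rel (boundaryJoin.{w} f m) V (fun n s hs ↦ ?_) (fun n s c c' h h' ↦ ?_)
    (fun n n' θ s c h ↦ ?_)).imp fun φ hφ ↦ ⟨fun n s ↦ hφ _ _ _ _ (Or.inl ⟨s, rfl, rfl⟩),
      fun n s ↦ hφ _ _ _ _ (Or.inr (Or.inl ⟨s, rfl, rfl⟩)),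
      fun n k t s ↦ hφ _ _ _ _ (Or.inr (Or.inr ⟨k, t, s, rfl, rfl⟩))⟩
  · obtain hs | ⟨i, hi⟩ := hs
    · obtain ⟨s', hs'⟩ := exists_comp_eq_of_range_subset hg s hs
      exact ⟨_, Or.inr (Or.inl ⟨s', hs', rfl⟩)⟩
    · obtain ⟨s', rfl⟩ | ⟨z, hz⟩ := exists_isLastLeft s
      · exact ⟨_, Or.inl ⟨s', rfl, rfl⟩⟩
      · refine ⟨_, Or.inr (Or.inr ⟨n, ⟨stdSimplex.objMk (leftPart s hz), fun h ↦ ?_⟩, standardize s,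
          (leftPart_comp_standardize s hz).symm, rfl⟩)⟩
        obtain ⟨x, hx⟩ := h i
        have := leftPart_mem_range s hz x
        exact hi (by rwa [← hx])
  · obtain ⟨s', rfl⟩ | ⟨z, hz⟩ := exists_isLastLeft s
    · rw [hbase n s' c h, hbase n s' c' h']
    -- On the overlap the values from `y` and `u` agree by `huy`, once both are in normal form.
    · have key (s' : Fin (n.unop.len + 1) →o Fin (m + 1) ⊕ₗ A)
          (hs' : s = (lexSumMap OrderHom.id f).comp s') (t : (∂Δ[m] : SSet.{w}).obj n)
          (ht : stdSimplex.asOrderHom t.1 = leftPart s hz) :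
          y.ev s' = Diag.ev (u.app n t).1 (standardize s) := by
        subst hs'
        have hz' : IsLastLeft s' z := hz.of_map
        rw [standardize_map, ← ev_restr, huy, ht, leftPart_map hz', ev_restr]
        exact congrArg y.ev (leftPart_comp_standardize s' hz').symm
      obtain ⟨s', hs', rfl⟩ | ⟨t, ht, rfl⟩ := hcan n s z hz c h <;>
      obtain ⟨s'', hs'', rfl⟩ | ⟨t', ht', rfl⟩ := hcan n s z hz c' h'
      · rw [comp_injective_of_le_iff hg (hs'.symm.trans hs'')]
      · exact key s' hs' t' ht'
      · exact (key s'' hs'' t ht).symm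
      · rw [show t = t' from Subtype.ext (stdSimplex.objEquiv.injective
          (SimplexCategory.Hom.ext _ _ (ht.trans ht'.symm)))]
  · obtain ⟨s', rfl, rfl⟩ | ⟨s', rfl, rfl⟩ | ⟨k, t, s', rfl, rfl⟩ := h
    · exact Or.inl ⟨s'.comp θ.unop.toOrderHom, rfl, map_ev _ _ _⟩
    · exact Or.inr (Or.inl ⟨s'.comp θ.unop.toOrderHom, rfl, map_ev _ _ _⟩)
    · exact Or.inr (Or.inr ⟨k, t, s'.comp θ.unop.toOrderHom, rfl, map_ev _ _ _⟩)

end SliceMap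

/-! ### Trivial fibrations between slices and transfer of final vertices -/

section FinalTransfer

open Diag SSet modelCategoryQuillen

variable {A B : Type} [PartialOrder A] [PartialOrder B] {C : SSet.{w}} {f : A →o B} {p : Diag B C}

/-- Criterion for the restriction map `C_{/p} ⟶ C_{/pf}` to be a trivial fibration. -/
lemma sliceOverMap_rlp (hf : ∀ a b, f a ≤ f b ↔ a ≤ b)
    (hext : ∀ (m : ℕ) (φ : (boundaryJoin.{w} f m : SSet.{w}) ⟶ C),
      (∀ (n : SimplexCategoryᵒᵖ) (s : Fin (n.unop.len + 1) →o B),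
        φ.app n ⟨_, inr_mem_boundaryJoin f s⟩ = p.ev s) →
      ∃ ψ : Diag (Fin (m + 1) ⊕ₗ B) C, (boundaryJoin.{w} f m).ι ≫ ψ = φ) :
    I.rlp (sliceOverMap f p) := by
  rintro _ _ _ ⟨m⟩
  refine ⟨fun {u y} sq ↦ ?_⟩
  -- By Yoneda the bottom map is an `m`-simplex of `C_{/pf}`, that is, a diagram on `Δᵐ ⋆ N(A)`.
  obtain ⟨y₀, rfl⟩ := (SSet.yonedaEquiv (n := ⦋m⦌)).symm.surjective y
  have hy (k : SimplexCategoryᵒᵖ) (t : (Δ[m] : SSet.{w}).obj k) :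
      (((SSet.yonedaEquiv (n := ⦋m⦌)).symm y₀).app k t).1 =
        Diag.restr (lexSumMap (stdSimplex.asOrderHom t) OrderHom.id) y₀.1 := rfl
  obtain ⟨φ, h₁, h₂, h₃⟩ := exists_boundaryJoin_hom hf u y₀.1 y₀.2 (fun k t ↦ by
    rw [← hy]
    exact congrArg Subtype.val (ConcreteCategory.congr_hom (NatTrans.congr_app sq.w k) t))
  obtain ⟨ψ, hψ⟩ := hext m φ h₁
  have hψ' (n : SimplexCategoryᵒᵖ) (s : Fin (n.unop.len + 1) →o Fin (m + 1) ⊕ₗ B)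
      (hs : simplex s ∈ (boundaryJoin.{w} f m).obj n) : ψ.ev s = φ.app n ⟨_, hs⟩ :=
    ConcreteCategory.congr_hom (NatTrans.congr_app hψ n) ⟨_, hs⟩
  let x : (sliceOver p).obj (op ⦋m⦌) :=
    ⟨ψ, ext_ev fun n s ↦ (hψ' n _ (inr_mem_boundaryJoin f s)).trans (h₁ n s)⟩
  refine ⟨⟨SSet.yonedaEquiv.symm x, ?_, ?_⟩⟩
  · refine NatTrans.ext (funext fun k ↦ ConcreteCategory.hom_ext _ _ fun t ↦ Subtype.ext ?_)
    exact ext_ev fun n s ↦ (hψ' n _ (bdry_mem_boundaryJoin f t s)).trans (h₃ n k t s)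
  · refine NatTrans.ext (funext fun k ↦ ConcreteCategory.hom_ext _ _ fun t ↦ Subtype.ext ?_)
    rw [hy]
    refine ext_ev fun n s ↦ ?_
    refine Eq.trans ?_ (h₂ n ((lexSumMap (stdSimplex.asOrderHom t) OrderHom.id).comp s))
    have e : (lexSumMap (stdSimplex.asOrderHom t) OrderHom.id).comp
        ((lexSumMap OrderHom.id f).comp s) = (lexSumMap OrderHom.id f).comp
          ((lexSumMap (stdSimplex.asOrderHom t) OrderHom.id).comp s) := by
      refine OrderHom.ext _ _ (funext fun x ↦ ?_)
      change lexSumMap _ _ (lexSumMap _ _ (s x)) = lexSumMap _ _ (lexSumMap _ _ (s x))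
      obtain ⟨a, ha⟩ | ⟨b, hb⟩ := lexSum_cases (s x)
      · rw [ha]; rfl
      · rw [hb]; rfl
    exact (congrArg ψ.ev e).trans (hψ' n _ (sub_mem_boundaryJoin f _))

/-- From left to right, lift the boundary to `S` with last vertex `x`, which is possible because the
inclusion of a vertex is a monomorphism, then fill it there and project. Conversely, fill the
projected boundary in `T` and lift the filler. -/
lemma isFinalVertex_iff_of_rlp {S T : SSet.{w}} {q : S ⟶ T} (hq : I.rlp q) (x : S _⦋0⦌) :
    IsFinalVertex x ↔ IsFinalVertex (q.app _ x) := by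
  constructor
  · intro hx n f hf
    let j : (Δ[0] : SSet.{w}) ⟶ ∂Δ[n + 1] :=
      SSet.yonedaEquiv.symm (boundaryVertex n (Fin.last (n + 1)))
    have : Mono j := stdSimplex.isTerminalObj₀.mono_from _
    have hj : SSet.yonedaEquiv.symm x ≫ q = j ≫ f := by
      rw [SSet.yonedaEquiv_symm_comp, SSet.yonedaEquiv_symm_comp, hf]
    rw [← rlp_monomorphisms] at hq
    have := hq j (.infer_property _)
    have sq : CommSq (SSet.yonedaEquiv.symm x) j q f := ⟨hj⟩
    obtain ⟨g, hg⟩ := hx n sq.lift (by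
      have := congrArg SSet.yonedaEquiv sq.fac_left
      rw [Equiv.apply_symm_apply] at this
      exact this)
    exact ⟨g ≫ q, by rw [reassoc_of% hg, sq.fac_right]⟩
  · intro hx n f hf
    obtain ⟨g, hg⟩ := hx n (f ≫ q) (congrArg (q.app _) hf)
    have := hq _ (boundary_ι_mem_I (n + 1))
    have sq : CommSq f ∂Δ[n + 1].ι q g := ⟨hg.symm⟩
    exact ⟨sq.lift, sq.fac_left⟩

lemma exists_of_notMem_boundaryJoin {m : ℕ} {n : SimplexCategoryᵒᵖ}
    {s : Fin (n.unop.len + 1) →o Fin (m + 1) ⊕ₗ B}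
    (hs : simplex s ∉ (boundaryJoin.{w} f m).obj n) :
    (∀ i, Sum.inlₗ i ∈ Set.range s) ∧ ∃ b, b ∉ Set.range f ∧ Sum.inrₗ b ∈ Set.range s := by
  rw [simplex_mem_boundaryJoin, not_or] at hs
  refine ⟨by simpa using hs.2, ?_⟩
  obtain ⟨q, hq, hq'⟩ := Set.not_subset.1 hs.1
  obtain ⟨a, rfl⟩ | ⟨b, rfl⟩ := lexSum_cases q
  · exact (hq' ⟨Sum.inlₗ a, rfl⟩).elim
  · exact ⟨b, fun ⟨a, ha⟩ ↦ hq' ⟨Sum.inrₗ a, congrArg _ ha⟩, hq⟩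

lemma notMem_boundaryJoin {m : ℕ} {n : SimplexCategoryᵒᵖ}
    {s : Fin (n.unop.len + 1) →o Fin (m + 1) ⊕ₗ B} (h : ∀ i, Sum.inlₗ i ∈ Set.range s)
    {b : B} (hb : b ∉ Set.range f) (hb' : Sum.inrₗ b ∈ Set.range s) :
    simplex s ∉ (boundaryJoin.{w} f m).obj n := by
  rw [simplex_mem_boundaryJoin, not_or]
  refine ⟨fun hs ↦ ?_, by simpa using h⟩
  obtain ⟨x, hx⟩ := hs hb'
  obtain ⟨a, rfl⟩ | ⟨a, rfl⟩ := lexSum_cases x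
  · cases hx
  · exact hb ⟨a, Sum.inr_injective hx⟩

lemma comparable_of_mem_range {l : ℕ} {Q : Type} [Preorder Q] (s : Fin (l + 1) →o Q) {a b : Q}
    (ha : a ∈ Set.range s) (hb : b ∈ Set.range s) : a ≤ b ∨ b ≤ a := by
  obtain ⟨i, rfl⟩ := ha
  obtain ⟨j, rfl⟩ := hb
  exact (le_total i j).imp (s.monotone ·) (s.monotone ·)

/-- The restriction map of slices along the inclusion of the complement of `x` is a trivial
fibration if there is `v < x` such that all elements comparable to `x` are comparable to `v`. -/
lemma sliceOverMap_rlp_of_lt [Quasicategory C] (hf : ∀ a b, f a ≤ f b ↔ a ≤ b) {x v : B}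
    (hx : ∀ y ∉ Set.range f, y = x) (hv : v < x) (hxv : ∀ y, y ≤ x ∨ x ≤ y → y ≤ v ∨ v ≤ y) :
    I.rlp (sliceOverMap f p) := by
  -- A missing simplex contains all of `Δᵐ` and `x`, and `v` lies strictly between these, so
  -- inserting or deleting `v` pairs the missing simplices.
  refine sliceOverMap_rlp hf fun m φ _ ↦ IsToggle.exists_extension (v := Sum.inrₗ v) ?_ φ
  have key {n : ℕ} {s : Fin (n + 1) →o Fin (m + 1) ⊕ₗ B}
      (hs : simplex (n := op ⦋n⦌) s ∉ (boundaryJoin.{w} f m).obj _) :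
      (∀ i, Sum.inlₗ i ∈ Set.range s) ∧ x ∉ Set.range f ∧ Sum.inrₗ x ∈ Set.range s := by
    obtain ⟨h, b, hb, hb'⟩ := exists_of_notMem_boundaryJoin hs
    obtain rfl := hx b hb
    exact ⟨h, hb, hb'⟩
  constructor
  · intro n s hs q hq
    obtain ⟨a, rfl⟩ | ⟨b, rfl⟩ := lexSum_cases q
    · exact Or.inl (Sum.Lex.inl_le_inr _ _)
    · refine (hxv b ?_).imp Sum.Lex.inr_le_inr_iff.2 Sum.Lex.inr_le_inr_iff.2
      exact (comparable_of_mem_range s hq (key hs).2.2).imp Sum.Lex.inr_le_inr_iff.1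
        Sum.Lex.inr_le_inr_iff.1
  · exact fun n s hs ↦ ⟨_, (key hs).1 0, Sum.Lex.inl_lt_inr _ _⟩
  · exact fun n s hs ↦ ⟨_, (key hs).2.2, Sum.Lex.inr_lt_inr_iff.2 hv⟩
  · intro n k s hs t ht
    refine notMem_boundaryJoin (n := op ⦋k⦌) (fun i ↦ ?_) (key hs).2.1 ?_
    · rw [ht]
      exact ⟨(key hs).1 i, fun h ↦ by cases h⟩
    · rw [ht]
      exact ⟨(key hs).2.2, fun h ↦ hv.ne' (Sum.inr_injective h)⟩

/-! ### Omitting an element which is a limit of the elements above it -/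

section Limit

variable {P : Type} [PartialOrder P] {g : P →o A} {b : B}

/-- The cone map. -/
def coneMap (h : P →o B) (b : B) (hb : ∀ z, b ≤ h z) : (Fin 1 ⊕ₗ P) →o B where
  toFun x := Sum.elim (fun _ ↦ b) h (ofLex x)
  monotone' := by
    intro x y hxy
    obtain ⟨a, rfl⟩ | ⟨a, rfl⟩ := lexSum_cases x <;>
    obtain ⟨c, rfl⟩ | ⟨c, rfl⟩ := lexSum_cases y
    · exact le_rfl
    · exact hb c
    · exact (Sum.Lex.not_inr_le_inl hxy).elim
    · exact h.monotone (Sum.Lex.inr_le_inr_iff.1 hxy)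

/-- The map `[m + 1] ⋆ P → [m] ⋆ B` sending the last element of `[m + 1]` to `b`. -/
def shiftFun (h : P →o B) (b : B) (m : ℕ) (x : Fin (m + 2) ⊕ₗ P) : Fin (m + 1) ⊕ₗ B :=
  Sum.elim (Fin.lastCases (motive := fun _ ↦ Fin (m + 1) ⊕ₗ B) (Sum.inrₗ b) Sum.inlₗ)
    (fun z ↦ Sum.inrₗ (h z)) (ofLex x)

lemma shiftFun_last (h : P →o B) (b : B) (m : ℕ) :
    shiftFun h b m (Sum.inlₗ (Fin.last _)) = Sum.inrₗ b :=
  Fin.lastCases_last (motive := fun _ ↦ Fin (m + 1) ⊕ₗ B)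

lemma shiftFun_castSucc (h : P →o B) (b : B) (m : ℕ) (i : Fin (m + 1)) :
    shiftFun h b m (Sum.inlₗ i.castSucc) = Sum.inlₗ i :=
  Fin.lastCases_castSucc (motive := fun _ ↦ Fin (m + 1) ⊕ₗ B) _

lemma shiftFun_inr (h : P →o B) (b : B) (m : ℕ) (z : P) :
    shiftFun h b m (Sum.inrₗ z) = Sum.inrₗ (h z) := rfl

omit [PartialOrder P] in
lemma shift_cases {m : ℕ} (x : Fin (m + 2) ⊕ₗ P) :
    x = Sum.inlₗ (Fin.last _) ∨ (∃ i : Fin (m + 1), x = Sum.inlₗ i.castSucc) ∨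
      ∃ z, x = Sum.inrₗ z := by
  obtain ⟨i, rfl⟩ | ⟨z, rfl⟩ := lexSum_cases x
  · induction i using Fin.lastCases with
    | last => exact Or.inl rfl
    | cast i => exact Or.inr (Or.inl ⟨i, rfl⟩)
  · exact Or.inr (Or.inr ⟨z, rfl⟩)

/-- `[m + 1] ⋆ P` is `[m] ⋆ {b} ⋆ P`, hence a full subposet of `[m] ⋆ B`. -/
lemma shiftFun_le_iff {h : P →o B} {b : B} (hb : ∀ z, b < h z) (hh : ∀ y z, h y ≤ h z ↔ y ≤ z)
    {m : ℕ} (x y : Fin (m + 2) ⊕ₗ P) : shiftFun h b m x ≤ shiftFun h b m y ↔ x ≤ y := by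
  obtain rfl | ⟨i, rfl⟩ | ⟨z, rfl⟩ := shift_cases x <;>
  obtain rfl | ⟨j, rfl⟩ | ⟨z', rfl⟩ := shift_cases y <;>
  simp only [shiftFun_last, shiftFun_castSucc, shiftFun_inr]
  · simp
  · exact iff_of_false Sum.Lex.not_inr_le_inl
      (fun h ↦ (Fin.castSucc_lt_last j).not_ge (Sum.Lex.inl_le_inl_iff.1 h))
  · exact iff_of_true (Sum.Lex.inr_le_inr_iff.2 (hb z').le) (Sum.Lex.inl_le_inr _ _)
  · exact iff_of_true (Sum.Lex.inl_le_inr _ _) (Sum.Lex.inl_le_inl_iff.2 (Fin.le_last _))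
  · exact Sum.Lex.inl_le_inl_iff.trans (Fin.castSucc_le_castSucc_iff.symm.trans
      Sum.Lex.inl_le_inl_iff.symm)
  · exact iff_of_true (Sum.Lex.inl_le_inr _ _) (Sum.Lex.inl_le_inr _ _)
  · exact iff_of_false (fun h ↦ (hb z).not_ge (Sum.Lex.inr_le_inr_iff.1 h))
      Sum.Lex.not_inr_le_inl
  · exact iff_of_false Sum.Lex.not_inr_le_inl Sum.Lex.not_inr_le_inl
  · exact Sum.Lex.inr_le_inr_iff.trans ((hh z z').trans Sum.Lex.inr_le_inr_iff.symm)

/-- Gluing of a map defined on a subcomplex and of a diagram. -/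
lemma exists_extension_of_comp {Q R : Type} [PartialOrder Q] [PartialOrder R]
    (A : (SSet.uliftFunctor.{w, 0}.obj (nerve Q)).Subcomplex) (φ : (A : SSet.{w}) ⟶ C)
    {γ : R →o Q} (hγ : ∀ a b, γ a ≤ γ b ↔ a ≤ b) (τ : Diag R C)
    (hτ : ∀ (n : SimplexCategoryᵒᵖ) (s : Fin (n.unop.len + 1) →o R)
      (hs : simplex (γ.comp s) ∈ A.obj n), φ.app n ⟨_, hs⟩ = τ.ev s)
    (h : ∀ (n : SimplexCategoryᵒᵖ) (s : Fin (n.unop.len + 1) →o Q),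
      simplex s ∉ A.obj n → Set.range s ⊆ Set.range γ) :
    ∃ ψ : Diag Q C, A.ι ≫ ψ = φ ∧ ψ.restr γ = τ := by
  refine (exists_of_rel (C := C) (Q := Q)
    (fun n s c ↦ (∃ hs : simplex s ∈ A.obj n, c = φ.app n ⟨_, hs⟩) ∨
      ∃ s' : Fin (n.unop.len + 1) →o R, s = γ.comp s' ∧ c = τ.ev s') (fun n s ↦ ?_)
    (fun n s c c' h h' ↦ ?_) (fun n m θ s c h ↦ ?_)).imp fun ψ hψ ↦
      ⟨NatTrans.ext (funext fun n ↦ ConcreteCategory.hom_ext _ _ fun x ↦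
        hψ n (toHom x.1) _ (Or.inl ⟨x.2, rfl⟩)), ext_ev fun n s ↦ hψ n _ _ (Or.inr ⟨s, rfl, rfl⟩)⟩
  · by_cases hs : simplex s ∈ A.obj n
    · exact ⟨_, Or.inl ⟨hs, rfl⟩⟩
    · obtain ⟨s', hs'⟩ := exists_comp_eq_of_range_subset hγ s (h n s hs)
      exact ⟨_, Or.inr ⟨s', hs', rfl⟩⟩
  · obtain ⟨hs, rfl⟩ | ⟨s', hs', rfl⟩ := h <;> obtain ⟨ht, rfl⟩ | ⟨t', ht', rfl⟩ := h'
    · rfl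
    · subst ht'
      exact hτ _ _ _
    · subst hs'
      exact (hτ _ _ _).symm
    · rw [comp_injective_of_le_iff hγ (hs'.symm.trans ht')]
  · obtain ⟨hs, rfl⟩ | ⟨s', hs', rfl⟩ := h
    · exact Or.inl ⟨A.map θ hs, (ConcreteCategory.congr_hom (φ.naturality θ) ⟨_, hs⟩).symm⟩
    · subst hs'
      exact Or.inr ⟨s'.comp θ.unop.toOrderHom, rfl, map_ev _ _ _⟩

/-- If `b` is the limit of the diagram on the elements comparable to `b`, all of which are larger
than `b`, then the restriction map of slices along the inclusion of the complement of `b` is a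
trivial fibration. -/
lemma sliceOverMap_rlp_of_isFinalVertex (hf : ∀ a b, f a ≤ f b ↔ a ≤ b) (hb : b ∉ Set.range f)
    (hb' : ∀ y ∉ Set.range f, y = b) (hg : ∀ y z, g y ≤ g z ↔ y ≤ z) (hgb : ∀ z, b < f (g z))
    (hcomp : ∀ y, y ≤ b ∨ b ≤ y → y = b ∨ y ∈ Set.range (f.comp g))
    (hfin : IsFinalVertex (S := sliceOver (p.restr (f.comp g)))
      (show {τ : Diag (Fin 1 ⊕ₗ P) C // τ.restr (lexSumInr _ _) = p.restr (f.comp g)} from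
      ⟨p.restr (coneMap (f.comp g) b fun z ↦ (hgb z).le), rfl⟩)) :
    I.rlp (sliceOverMap f p) := by
  refine sliceOverMap_rlp hf fun m φ hφ ↦ ?_
  have hfg (y z) : (f.comp g) y ≤ (f.comp g) z ↔ y ≤ z := (hf _ _).trans (hg _ _)
  let γ : (Fin (m + 2) ⊕ₗ P) →o (Fin (m + 1) ⊕ₗ B) :=
    ⟨shiftFun (f.comp g) b m, fun x y h ↦ (shiftFun_le_iff hgb hfg x y).2 h⟩
  have hγ (x y) : γ x ≤ γ y ↔ x ≤ y := shiftFun_le_iff hgb hfg x y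
  -- The subcomplex meets `Δᵐ⁺¹ ⋆ N(P)` exactly in `∂Δᵐ⁺¹ ⋆ N(P)`: a missing simplex is one
  -- containing all of `Δᵐ` and `b`, and `b` is the last vertex of `Δᵐ⁺¹`.
  have hmem {n : SimplexCategoryᵒᵖ} (s : Fin (n.unop.len + 1) →o Fin (m + 2) ⊕ₗ P) :
      simplex (γ.comp s) ∈ (boundaryJoin.{w} f m).obj n ↔
        ∃ i : Fin (m + 2), Sum.inlₗ i ∉ Set.range s := by
    constructor
    · intro hs
      by_contra! h
      refine notMem_boundaryJoin (f := f) (s := γ.comp s) (fun i ↦ ?_) hb ?_ hs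
      · obtain ⟨x, hx⟩ := h i.castSucc
        exact ⟨x, (congrArg γ hx).trans (shiftFun_castSucc (f.comp g) b m i)⟩
      · obtain ⟨x, hx⟩ := h (Fin.last _)
        exact ⟨x, (congrArg γ hx).trans (shiftFun_last (f.comp g) b m)⟩
    · rintro ⟨i, hi⟩
      by_contra hs
      obtain ⟨h₁, b', hb₁, ⟨x, hx⟩⟩ := exists_of_notMem_boundaryJoin hs
      obtain rfl := hb' b' hb₁
      have hlast : Sum.inlₗ (Fin.last _) ∈ Set.range s := by
        refine ⟨x, ?_⟩
        change shiftFun _ _ _ (s x) = _ at hx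
        obtain h | ⟨j, h⟩ | ⟨z, h⟩ := shift_cases (s x)
        · exact h
        · rw [h, shiftFun_castSucc] at hx
          cases hx
        · rw [h, shiftFun_inr] at hx
          exact (hb ⟨_, Sum.inr_injective hx⟩).elim
      induction i using Fin.lastCases with
      | last => exact hi hlast
      | cast i =>
        obtain ⟨y, hy⟩ := h₁ i
        change shiftFun _ _ _ (s y) = _ at hy
        obtain h | ⟨j, h⟩ | ⟨z, h⟩ := shift_cases (s y)
        · rw [h, shiftFun_last] at hy
          cases hy
        · rw [h, shiftFun_castSucc] at hy
          rw [Sum.inl_injective hy] at h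
          exact hi ⟨y, h⟩
        · rw [h, shiftFun_inr] at hy
          cases hy
  have hmem' {n k : SimplexCategoryᵒᵖ} (t : (∂Δ[m + 1] : SSet.{w}).obj k)
      (s : Fin (n.unop.len + 1) →o Fin (k.unop.len + 1) ⊕ₗ P) :
      simplex (γ.comp ((lexSumMap (stdSimplex.asOrderHom t.1) OrderHom.id).comp s)) ∈
        (boundaryJoin.{w} f m).obj n := by
    refine (hmem _).2 ?_
    obtain ⟨t, ht⟩ := t
    have ht' : ¬ Function.Surjective (stdSimplex.asOrderHom t) := ht
    simp only [Function.Surjective, not_forall, not_exists] at ht'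
    obtain ⟨i, hi⟩ := ht'
    refine ⟨i, fun ⟨x, hx⟩ ↦ ?_⟩
    change lexSumMap _ _ (s x) = _ at hx
    obtain ⟨a, ha⟩ | ⟨b, hb⟩ := lexSum_cases (s x)
    · rw [ha, lexSumMap_inl] at hx
      exact hi a (Sum.inl_injective hx)
    · rw [hb] at hx
      cases hx
  have hφ' {n : SimplexCategoryᵒᵖ} {s t : Fin (n.unop.len + 1) →o Fin (m + 1) ⊕ₗ B}
      (hs : simplex s ∈ (boundaryJoin.{w} f m).obj n) (ht : simplex t ∈ (boundaryJoin.{w} f m).obj n)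
      (e : ∀ x, s x = t x) : φ.app n ⟨_, hs⟩ = φ.app n ⟨_, ht⟩ := by
    obtain rfl : s = t := OrderHom.ext _ _ (funext e)
    rfl
  -- The restriction of `φ` to `∂Δᵐ⁺¹ ⋆ N(P)`, read as a map into the slice.
  let u : (∂Δ[m + 1] : SSet.{w}) ⟶ sliceOver (p.restr (f.comp g)) :=
    { app k := ↾ fun t ↦ ⟨ofEv (fun {n} s ↦ φ.app n ⟨_, hmem' t s⟩)
        (fun {n n'} θ s ↦ (ConcreteCategory.congr_hom (φ.naturality θ) ⟨_, hmem' t s⟩).symm),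
        ext_ev fun n s ↦ hφ n ((f.comp g).comp s)⟩
      naturality k k' θ := ConcreteCategory.hom_ext _ _ fun t ↦ Subtype.ext (ext_ev fun n s ↦ by
        refine hφ' _ _ fun x ↦ ?_
        change γ (lexSumMap _ _ (s x)) = γ (lexSumMap _ _ (lexSumMap _ _ (s x)))
        obtain ⟨a, ha⟩ | ⟨b, hb⟩ := lexSum_cases (s x)
        · rw [ha]; rfl
        · rw [hb]; rfl) }
  have hlast (n : SimplexCategoryᵒᵖ) (s : Fin (n.unop.len + 1) →o Fin 1 ⊕ₗ P)
      (x : Fin (n.unop.len + 1)) :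
      γ (lexSumMap (stdSimplex.asOrderHom (boundaryVertex.{w} m (Fin.last (m + 1))).1)
        OrderHom.id (s x)) = Sum.inrₗ (coneMap (f.comp g) b (fun z ↦ (hgb z).le) (s x)) := by
    obtain ⟨a, ha⟩ | ⟨c, hc⟩ := lexSum_cases (s x)
    · rw [ha]
      exact shiftFun_last (f.comp g) b m
    · rw [hc]; rfl
  -- The last vertex of `u` is the cone with apex `b`, so its finality fills the boundary and gives
  -- `τ` on `Δᵐ⁺¹ ⋆ N(P)`.
  obtain ⟨G, hG⟩ := hfin m u (Subtype.ext (ext_ev fun n s ↦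
    (hφ' _ (inr_mem_boundaryJoin f
      ((coneMap (f.comp g) b fun z ↦ (hgb z).le).comp s)) (hlast n s)).trans (hφ n _)))
  obtain ⟨⟨τ, hτ₀⟩, rfl⟩ := (SSet.yonedaEquiv (n := ⦋m + 1⦌)).symm.surjective G
  have hτ (n : SimplexCategoryᵒᵖ) (t : (∂Δ[m + 1] : SSet.{w}).obj n)
      (s : Fin (n.unop.len + 1) →o Fin (n.unop.len + 1) ⊕ₗ P) :
      Diag.ev (P := Fin (m + 2) ⊕ₗ P) τ
        ((lexSumMap (stdSimplex.asOrderHom t.1) OrderHom.id).comp s) =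
        φ.app n ⟨_, hmem' t s⟩ := by
    have h := ConcreteCategory.congr_hom (NatTrans.congr_app hG n) t
    have h' : Diag.restr (lexSumMap (stdSimplex.asOrderHom t.1) OrderHom.id) τ = (u.app n t).1 :=
      congrArg Subtype.val h
    exact congrArg (fun τ ↦ Diag.ev τ s) h'
  refine (exists_extension_of_comp _ φ hγ τ (fun n s hs ↦ ?_) (fun n s hs ↦ ?_)).imp
    fun _ h ↦ h.1
  · obtain ⟨i, hi⟩ := (hmem s).1 hs
    obtain ⟨s', rfl⟩ | ⟨z, hz⟩ := exists_isLastLeft s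
    · refine (hφ n ((f.comp g).comp s')).trans ?_
      exact congrArg (fun τ ↦ Diag.ev τ s') hτ₀.symm
    · have e := leftPart_comp_standardize s hz
      let t : (∂Δ[m + 1] : SSet.{w}).obj n := ⟨stdSimplex.objMk (leftPart s hz), fun h ↦ by
        obtain ⟨x, hx⟩ := h i
        have := leftPart_mem_range s hz x
        exact hi (by rwa [← hx])⟩
      refine (hφ' hs (hmem' t (standardize s)) fun x ↦ ?_).trans
        ((hτ n t (standardize s)).symm.trans (congrArg (Diag.ev (P := Fin (m + 2) ⊕ₗ P) τ) e))
      exact congrArg γ (DFunLike.congr_fun e.symm x)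
  -- A missing simplex contains `b`, so by `hcomp` its other vertices in `B` come from `P`; it
  -- therefore lies in `Δᵐ⁺¹ ⋆ N(P)`, where `τ` is defined.
  · obtain ⟨h₁, b', hb₁, h₂⟩ := exists_of_notMem_boundaryJoin hs
    obtain rfl := hb' b' hb₁
    intro q hq
    obtain ⟨i, rfl⟩ | ⟨y, rfl⟩ := lexSum_cases q
    · exact ⟨Sum.inlₗ i.castSucc, shiftFun_castSucc (f.comp g) _ m i⟩
    · obtain rfl | ⟨z, rfl⟩ := hcomp y ((comparable_of_mem_range s hq h₂).imp
        Sum.Lex.inr_le_inr_iff.1 Sum.Lex.inr_le_inr_iff.1)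
      · exact ⟨Sum.inlₗ (Fin.last _), shiftFun_last (f.comp g) _ m⟩
      · exact ⟨Sum.inrₗ z, rfl⟩

end Limit

end FinalTransfer

lemma Diag.restr_congr {P Q : Type} [Preorder P] [Preorder Q] {C : SSet.{w}} (τ : Diag Q C)
    {f g : P →o Q} (h : ∀ x, f x = g x) : τ.restr f = τ.restr g :=
  congrArg (Diag.restr · τ) (OrderHom.ext _ _ (funext h))

/-! ### Limit cones and transposition of squares -/

section LimitCones

open Diag SSet modelCategoryQuillen

variable {C : SSet.{w}}

/-- A cone in a simplicial set is a limit cone if it is final in the slice over its base. -/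
def IsLimitCone {P : Type} [Preorder P] (τ : Diag (Fin 1 ⊕ₗ P) C) : Prop :=
  IsFinalVertex (S := sliceOver (τ.restr (lexSumInr _ P)))
    (show {τ' : Diag (Fin 1 ⊕ₗ P) C // τ'.restr (lexSumInr _ _) = τ.restr (lexSumInr _ P)} from
      ⟨τ, rfl⟩)

lemma isLimitCone_iff_of_rlp {A B : Type} [PartialOrder A] [PartialOrder B] {f : A →o B}
    (τ : Diag (Fin 1 ⊕ₗ B) C) (h : I.rlp (sliceOverMap f (τ.restr (lexSumInr _ B)))) :
    IsLimitCone τ ↔ IsLimitCone (τ.restr (lexSumMap OrderHom.id f)) :=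
  isFinalVertex_iff_of_rlp h _

lemma isPullbackSquare_iff (σ : Diag SquareShape C) :
    IsPullbackSquare σ ↔ IsLimitCone (σ.restr cospanConeHom) := Iff.rfl

/-- Here `f` is an isomorphism of posets and no simplex is missing, so the toggle conditions are
vacuous and the vertex chosen is irrelevant. -/
lemma sliceOverMap_rlp_of_surjective [Quasicategory C] {A B : Type} [PartialOrder A]
    [PartialOrder B] {f : A →o B} {p : Diag B C} (hf : ∀ a b, f a ≤ f b ↔ a ≤ b)
    (hf' : Function.Surjective f) : I.rlp (sliceOverMap f p) := by
  refine sliceOverMap_rlp hf fun m φ _ ↦ IsToggle.exists_extension (v := Sum.inlₗ 0) ?_ φ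
  have key {n : ℕ} {s : Fin (n + 1) →o Fin (m + 1) ⊕ₗ B}
      (hs : simplex (n := op ⦋n⦌) s ∉ (boundaryJoin.{w} f m).obj _) : False := by
    obtain ⟨h, b, hb, hb'⟩ := exists_of_notMem_boundaryJoin hs
    exact hb (hf' b)
  constructor
  · exact fun n s hs ↦ (key hs).elim
  · exact fun n s hs ↦ (key hs).elim
  · exact fun n s hs ↦ (key hs).elim
  · exact fun n k s hs ↦ (key hs).elim

namespace SquareShape

instance : DecidableEq SquareShape := inferInstanceAs (DecidableEq (Fin 2 × Fin 2))
instance : Fintype SquareShape := inferInstanceAs (Fintype (Fin 2 × Fin 2))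
instance : DecidableLE SquareShape := inferInstanceAs (DecidableLE (Fin 2 × Fin 2))

/-- The transposition of squares. -/
def swap : SquareShape →o SquareShape where
  toFun x := ((x.2, x.1) : Fin 2 × Fin 2)
  monotone' _ _ h := ⟨h.2, h.1⟩

/-- The transposition of cospans. -/
def cospanSwap : CospanShape →o CospanShape where
  toFun x := ⟨swap x.1, by revert x; decide⟩
  monotone' _ _ h := swap.monotone h

/-- The inclusion of the left square of a rectangle. -/
def left : SquareShape →o Fin 2 × Fin 3 where
  toFun x := (x.1, x.2.castSucc)
  monotone' _ _ h := ⟨h.1, h.2⟩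

/-- The inclusion of the right square of a rectangle. -/
def right : SquareShape →o Fin 2 × Fin 3 where
  toFun x := (x.1, x.2.succ)
  monotone' _ _ h := ⟨h.1, Fin.succ_le_succ_iff.2 h.2⟩

/-- The inclusion of the outer square of a rectangle. -/
def outer : SquareShape →o Fin 2 × Fin 3 where
  toFun x := (x.1, Fin.succAbove 1 x.2)
  monotone' _ _ h := ⟨h.1, (Fin.strictMono_succAbove 1).monotone h.2⟩

end SquareShape

lemma isPullbackSquare_swap_iff [Quasicategory C] (σ : Diag SquareShape C) :
    IsPullbackSquare (σ.restr SquareShape.swap) ↔ IsPullbackSquare σ := by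
  rw [isPullbackSquare_iff, isPullbackSquare_iff]
  refine Iff.trans (Iff.of_eq ?_) (isLimitCone_iff_of_rlp (f := SquareShape.cospanSwap) _
    (sliceOverMap_rlp_of_surjective (by decide) (by decide))).symm
  congr 1
  change σ.restr (SquareShape.swap.comp cospanConeHom) =
    σ.restr (cospanConeHom.comp (lexSumMap OrderHom.id SquareShape.cospanSwap))
  refine σ.restr_congr fun x ↦ ?_
  obtain ⟨a, rfl⟩ | ⟨a, rfl⟩ := lexSum_cases x <;> rfl

/-! ### The pasting law for pullback squares -/

section Pasting

/-- The rectangle without its top left corner. -/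
abbrev PastingShape : Type := {x : Fin 2 × Fin 3 // x ≠ (0, 0)}

/-- The rectangle without its top left and top right corners. -/
abbrev PastingShapeLeft : Type := {x : Fin 2 × Fin 3 // x ≠ (0, 0) ∧ x ≠ (0, 2)}

/-- The rectangle without its top left and top middle vertices. -/
abbrev PastingShapeRight : Type := {x : Fin 2 × Fin 3 // x ≠ (0, 0) ∧ x ≠ (0, 1)}

/-- The cone over the rectangle without its top left corner. -/
def pastingConeHom : (Fin 1 ⊕ₗ PastingShape) →o Fin 2 × Fin 3 where
  toFun x := Sum.elim (fun _ ↦ (0, 0)) Subtype.val (ofLex x)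
  monotone' := by
    intro x y h
    rw [Sum.Lex.le_def] at h
    cases h with
    | inl h => exact le_rfl
    | inr h => exact h
    | sep a b => exact ⟨Fin.zero_le _, Fin.zero_le _⟩

/-- The inclusion of `PastingShapeLeft`. -/
def pastingLeftHom : PastingShapeLeft →o PastingShape :=
  ⟨fun x ↦ ⟨x.1, x.2.1⟩, fun _ _ h ↦ h⟩

/-- The inclusion of `PastingShapeRight`. -/
def pastingRightHom : PastingShapeRight →o PastingShape :=
  ⟨fun x ↦ ⟨x.1, x.2.1⟩, fun _ _ h ↦ h⟩

/-- The inclusion of the cospan of the left square. -/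
def cospanLeftHom : CospanShape →o PastingShapeLeft :=
  ⟨fun x ↦ ⟨SquareShape.left x.1, by revert x; decide⟩, fun _ _ h ↦ SquareShape.left.monotone h⟩

/-- The inclusion of the cospan of the outer square. -/
def cospanOuterHom : CospanShape →o PastingShapeRight :=
  ⟨fun x ↦ ⟨SquareShape.outer x.1, by revert x; decide⟩, fun _ _ h ↦ SquareShape.outer.monotone h⟩

/-- The inclusion of the cospan of the right square. -/
def cospanRightHom : CospanShape →o PastingShapeRight :=
  ⟨fun x ↦ ⟨SquareShape.right x.1, by revert x; decide⟩, fun _ _ h ↦ SquareShape.right.monotone h⟩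

/-- The pasting law for pullback squares. -/
lemma isPullbackSquare_left_iff [Quasicategory C] (T : Diag (Fin 2 × Fin 3) C)
    (h : IsPullbackSquare (T.restr SquareShape.right)) :
    IsPullbackSquare (T.restr SquareShape.left) ↔ IsPullbackSquare (T.restr SquareShape.outer) := by
  -- Both conditions are compared with the corner `(0, 0)` being the limit of the rest of the
  -- rectangle. Here `(0, 2)` and then `(1, 2)` are redundant, since `(0, 1)` and `(1, 1)` precede
  -- them; the left cospan remains.
  have h₁ : IsLimitCone (T.restr pastingConeHom) ↔
      IsPullbackSquare (T.restr SquareShape.left) := by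
    rw [isPullbackSquare_iff]
    refine ((isLimitCone_iff_of_rlp (f := pastingLeftHom) _ (sliceOverMap_rlp_of_lt
      (x := ⟨(0, 2), by decide⟩) (v := ⟨(0, 1), by decide⟩) (by decide) (by decide) (lt_iff_le_not_ge.2 (by decide))
      (by decide))).trans (isLimitCone_iff_of_rlp (f := cospanLeftHom) _ (sliceOverMap_rlp_of_lt
      (x := ⟨(1, 2), by decide⟩) (v := ⟨(1, 1), by decide⟩) (by decide) (by decide) (lt_iff_le_not_ge.2 (by decide))
      (by decide)))).trans (Iff.of_eq ?_)
    congr 1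
    refine T.restr_congr (f := pastingConeHom.comp ((lexSumMap OrderHom.id pastingLeftHom).comp
      (lexSumMap OrderHom.id cospanLeftHom))) (g := SquareShape.left.comp cospanConeHom) fun x ↦ ?_
    obtain ⟨a, rfl⟩ | ⟨a, rfl⟩ := lexSum_cases x <;> rfl
  -- Here `(0, 1)` may be omitted because it is the limit of the right cospan, by `h`; then `(1, 1)`
  -- is redundant because of `(1, 0)`, and the outer cospan remains.
  have h₂ : IsLimitCone (T.restr pastingConeHom) ↔
      IsPullbackSquare (T.restr SquareShape.outer) := by
    rw [isPullbackSquare_iff]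
    refine ((isLimitCone_iff_of_rlp (f := pastingRightHom) _ (sliceOverMap_rlp_of_isFinalVertex
      (g := cospanRightHom) (b := ⟨(0, 1), by decide⟩) (by decide) (by decide) (by decide)
      (by decide) (fun z ↦ lt_iff_le_not_ge.2 (by revert z; decide)) (by decide) ?_)).trans
      (isLimitCone_iff_of_rlp (f := cospanOuterHom) _ (sliceOverMap_rlp_of_lt
      (x := ⟨(1, 1), by decide⟩) (v := ⟨(1, 0), by decide⟩) (by decide) (by decide) (lt_iff_le_not_ge.2 (by decide))
      (by decide)))).trans (Iff.of_eq ?_)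
    · rw [isPullbackSquare_iff] at h
      have e : (T.restr SquareShape.right).restr cospanConeHom =
          ((T.restr pastingConeHom).restr (lexSumInr _ _)).restr
            (coneMap (pastingRightHom.comp cospanRightHom) ⟨(0, 1), by decide⟩ (by decide)) := by
        refine T.restr_congr (f := SquareShape.right.comp cospanConeHom) (g := pastingConeHom.comp
          ((lexSumInr _ _).comp (coneMap (pastingRightHom.comp cospanRightHom)
            ⟨(0, 1), by decide⟩ (by decide)))) fun x ↦ ?_
        obtain ⟨a, rfl⟩ | ⟨a, rfl⟩ := lexSum_cases x <;> rfl
      rw [e] at h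
      exact h
    · congr 1
      refine T.restr_congr (f := pastingConeHom.comp ((lexSumMap OrderHom.id pastingRightHom).comp
        (lexSumMap OrderHom.id cospanOuterHom))) (g := SquareShape.outer.comp cospanConeHom) fun x ↦ ?_
      obtain ⟨a, rfl⟩ | ⟨a, rfl⟩ := lexSum_cases x <;> rfl
  exact h₁.symm.trans h₂

end Pasting

end LimitCones

/-! ### Duality -/

section Duality

open Diag SSet

lemma Diag.ext_toHom {Q : Type} [Preorder Q] {n : SimplexCategoryᵒᵖ}
    {x y : (SSet.uliftFunctor.{w, 0}.obj (nerve Q)).obj n} (h : ∀ i, toHom x i = toHom y i) :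
    x = y :=
  congrArg simplex (OrderHom.ext _ _ (funext h))

/-- The morphism in `SimplexCategoryᵒᵖ` obtained by reversing a morphism. -/
def revOp {n m : SimplexCategoryᵒᵖ} (θ : n ⟶ m) : n ⟶ m :=
  (SimplexCategory.rev.map θ.unop).op

lemma revOp_revOp {n m : SimplexCategoryᵒᵖ} (θ : n ⟶ m) : revOp (revOp θ) = θ :=
  congrArg Quiver.Hom.op (SimplexCategory.rev_map_rev_map θ.unop)

/-- An identification of a simplicial set with the opposite of another simplicial set. -/
structure AntiIso (X Y : SSet.{w}) where
  /-- the bijection on simplices -/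
  equiv (n : SimplexCategoryᵒᵖ) : X.obj n ≃ Y.obj n
  equiv_map {n m : SimplexCategoryᵒᵖ} (θ : n ⟶ m) (x : X.obj n) :
    equiv m (X.map θ x) = Y.map (revOp θ) (equiv n x)

namespace AntiIso

variable {X Y S T : SSet.{w}}

/-- The inverse of an anti-isomorphism. -/
def symm (a : AntiIso X Y) : AntiIso Y X where
  equiv n := (a.equiv n).symm
  equiv_map θ y := (a.equiv _).injective (by
    rw [a.equiv_map, Equiv.apply_symm_apply, Equiv.apply_symm_apply, revOp_revOp])

/-- Conjugation by anti-isomorphisms. -/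
def conj (a : AntiIso X Y) (b : AntiIso S T) (f : X ⟶ S) : Y ⟶ T where
  app n := ↾ fun y ↦ b.equiv n (f.app n ((a.equiv n).symm y))
  naturality n m θ := ConcreteCategory.hom_ext _ _ fun y ↦ by
    change b.equiv m (f.app m (a.symm.equiv m (Y.map θ y))) =
      T.map θ (b.equiv n (f.app n (a.symm.equiv n y)))
    rw [a.symm.equiv_map]
    refine (congrArg (b.equiv m) (ConcreteCategory.congr_hom (f.naturality (revOp θ)) _)).trans ?_
    exact (b.equiv_map (revOp θ) _).trans (congrArg (fun θ ↦ T.map θ _) (revOp_revOp θ))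

/-- The standard simplices are self-dual. -/
def stdSimplex (n : SimplexCategory) : AntiIso (SSet.stdSimplex.{w}.obj n) (SSet.stdSimplex.obj n) where
  equiv _ :=
    { toFun t := SSet.stdSimplex.objEquiv.symm (SimplexCategory.rev.map (SSet.stdSimplex.objEquiv t))
      invFun t := SSet.stdSimplex.objEquiv.symm (SimplexCategory.rev.map (SSet.stdSimplex.objEquiv t))
      left_inv _ := SSet.stdSimplex.objEquiv.injective (SimplexCategory.rev_map_rev_map _)
      right_inv _ := SSet.stdSimplex.objEquiv.injective (SimplexCategory.rev_map_rev_map _) }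
  equiv_map _ _ := SSet.stdSimplex.objEquiv.injective (SimplexCategory.rev.map_comp _ _)

/-- Restriction of an anti-isomorphism to subcomplexes. -/
def subcomplex (a : AntiIso X Y) (A : X.Subcomplex) (B : Y.Subcomplex)
    (h : ∀ (n : SimplexCategoryᵒᵖ) (x : X.obj n), x ∈ A.obj n ↔ a.equiv n x ∈ B.obj n) :
    AntiIso (A : SSet.{w}) (B : SSet.{w}) where
  equiv n := (a.equiv n).subtypeEquiv (h n)
  equiv_map θ x := Subtype.ext (a.equiv_map θ x.1)

lemma symm_conj_conj (a : AntiIso X Y) (b : AntiIso S T) (f : X ⟶ S) :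
    a.symm.conj b.symm (a.conj b f) = f :=
  NatTrans.ext (funext fun n ↦ ConcreteCategory.hom_ext _ _ fun x ↦
    ((b.equiv n).symm_apply_apply _).trans
      (congrArg (f.app n) ((a.equiv n).symm_apply_apply x)))

lemma conj_conj_symm (a : AntiIso X Y) (b : AntiIso S T) (f : Y ⟶ T) :
    a.conj b (a.symm.conj b.symm f) = f :=
  a.symm.symm_conj_conj b.symm f

/-- Transports extension problems: an extension of the reversed map, reversed back, extends `f`. -/
lemma ι_comp_conj (a : AntiIso X Y) (b : AntiIso S T) {A : X.Subcomplex} {B : Y.Subcomplex}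
    (h : ∀ (n : SimplexCategoryᵒᵖ) (x : X.obj n), x ∈ A.obj n ↔ a.equiv n x ∈ B.obj n)
    {f : (B : SSet.{w}) ⟶ T} {g : X ⟶ S}
    (hg : A.ι ≫ g = (a.subcomplex A B h).symm.conj b.symm f) : B.ι ≫ a.conj b g = f := by
  refine Eq.trans ?_ ((a.subcomplex A B h).conj_conj_symm b f)
  rw [← hg]
  rfl

/-- The boundaries of standard simplices are self-dual. -/
def boundary (n : ℕ) : AntiIso (∂Δ[n] : SSet.{w}) (∂Δ[n] : SSet.{w}) :=
  (AntiIso.stdSimplex ⦋n⦌).subcomplex _ _ fun k x ↦ by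
    refine not_congr ⟨fun h i ↦ ?_, fun h i ↦ ?_⟩
    · obtain ⟨j, hj⟩ := h i.rev
      refine ⟨j.rev, ?_⟩
      change (SSet.stdSimplex.asOrderHom x j.rev.rev).rev = i
      rw [Fin.rev_rev]
      exact (congrArg Fin.rev hj).trans (Fin.rev_rev _)
    · obtain ⟨j, hj⟩ := h i.rev
      exact ⟨j.rev, Fin.rev_injective hj⟩

/-- The dual of a horn is a horn. -/
def horn (n : ℕ) (i : Fin (n + 1)) : AntiIso (Λ[n, i] : SSet.{w}) (Λ[n, i.rev] : SSet.{w}) :=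
  (AntiIso.stdSimplex ⦋n⦌).subcomplex _ _ fun k x ↦ by
    rw [mem_horn_iff, mem_horn_iff, not_iff_not, Set.eq_univ_iff_forall, Set.eq_univ_iff_forall]
    refine ⟨fun h j ↦ ?_, fun h j ↦ ?_⟩
    · obtain ⟨l, hl⟩ | hj := h j.rev
      · refine Or.inl ⟨l.rev, ?_⟩
        change (SSet.stdSimplex.asOrderHom x l.rev.rev).rev = j
        rw [Fin.rev_rev]
        exact (congrArg Fin.rev hl).trans (Fin.rev_rev _)
      · exact Or.inr (Fin.rev_eq_iff.1 hj)
    · obtain ⟨l, hl⟩ | hj := h j.rev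
      · exact Or.inl ⟨l.rev, Fin.rev_injective hl⟩
      · exact Or.inr (Fin.rev_injective hj)

/-- The tautological anti-isomorphism. -/
def op (X : SSet.{w}) : AntiIso X X.op where
  equiv _ := opObjEquiv.symm
  equiv_map θ x := congrArg (fun θ ↦ opObjEquiv.symm (X.map θ x)) (revOp_revOp θ).symm

/-- Reversal preserves the boundary of a simplex and exchanges its first and last vertices. -/
lemma isFinalVertex_equiv (a : AntiIso S T) {x : S _⦋0⦌} (hx : IsInitialVertex x) :
    IsFinalVertex (a.equiv _ x) := by
  intro n f hf
  obtain ⟨g, hg⟩ := hx n ((boundary (n + 1)).symm.conj a.symm f) (by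
    refine Eq.trans ?_ ((a.equiv _).symm_apply_apply x)
    rw [← hf]
    refine congrArg (fun t ↦ (a.equiv _).symm (f.app _ t)) (Subtype.ext ?_)
    exact SSet.stdSimplex.objEquiv.injective (SimplexCategory.Hom.ext _ _
      (OrderHom.ext _ _ (funext fun j ↦ Fin.rev_zero _))))
  exact ⟨_, ι_comp_conj _ a _ hg⟩

lemma isInitialVertex_equiv (a : AntiIso S T) {x : S _⦋0⦌} (hx : IsFinalVertex x) :
    IsInitialVertex (a.equiv _ x) := by
  intro n f hf
  obtain ⟨g, hg⟩ := hx n ((boundary (n + 1)).symm.conj a.symm f) (by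
    refine Eq.trans ?_ ((a.equiv _).symm_apply_apply x)
    rw [← hf]
    refine congrArg (fun t ↦ (a.equiv _).symm (f.app _ t)) (Subtype.ext ?_)
    exact SSet.stdSimplex.objEquiv.injective (SimplexCategory.Hom.ext _ _
      (OrderHom.ext _ _ (funext fun j ↦ Fin.rev_last _))))
  exact ⟨_, ι_comp_conj _ a _ hg⟩

lemma isInitialVertex_iff (a : AntiIso S T) (x : S _⦋0⦌) :
    IsInitialVertex x ↔ IsFinalVertex (a.equiv _ x) := by
  refine ⟨a.isFinalVertex_equiv, fun h ↦ ?_⟩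
  have := a.symm.isInitialVertex_equiv h
  rwa [show a.symm.equiv _ (a.equiv _ x) = x from (a.equiv _).symm_apply_apply x] at this

/-- Reversal turns the horn at `i` into the horn at `i.rev`, and inner horns into inner horns. -/
lemma quasicategory (a : AntiIso S T) [Quasicategory S] : Quasicategory T where
  hornFilling' := by
    intro n i f h0 hn
    obtain ⟨i, rfl⟩ := Fin.rev_surjective i
    obtain ⟨g, hg⟩ := Quasicategory.hornFilling' (S := S) (n := n) (i := i)
      ((horn (n + 2) i).symm.conj a.symm f)
      (by rwa [← Fin.rev_zero, Fin.rev_lt_rev] at hn)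
      (by rwa [← Fin.rev_last, Fin.rev_lt_rev] at h0)
    exact ⟨_, (ι_comp_conj _ a _ hg.symm).symm⟩

/-- The nerve of a preorder and the nerve of the opposite preorder. -/
def nerve {P Q : Type} [Preorder P] [Preorder Q] (e : Pᵒᵈ ≃o Q) :
    AntiIso (SSet.uliftFunctor.{w, 0}.obj (CategoryTheory.nerve P))
      (SSet.uliftFunctor.{w, 0}.obj (CategoryTheory.nerve Q)) where
  equiv n :=
    { toFun x := simplex ⟨fun i ↦ e (OrderDual.toDual (toHom x i.rev)), fun i j h ↦
        e.monotone ((toHom x).monotone (Fin.rev_le_rev.2 h))⟩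
      invFun y := simplex ⟨fun i ↦ OrderDual.ofDual (e.symm (toHom y i.rev)), fun i j h ↦
        e.symm.monotone ((toHom y).monotone (Fin.rev_le_rev.2 h))⟩
      left_inv x := congrArg simplex (OrderHom.ext _ (toHom x) (funext fun i ↦
        (e.symm_apply_apply _).trans (congrArg (toHom x) (Fin.rev_rev i))))
      right_inv y := congrArg simplex (OrderHom.ext _ (toHom y) (funext fun i ↦
        (e.apply_symm_apply _).trans (congrArg (toHom y) (Fin.rev_rev i)))) }
  equiv_map {n m} θ x := ext_toHom fun i ↦ by
    change e (OrderDual.toDual (toHom x (θ.unop.toOrderHom i.rev))) =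
      e (OrderDual.toDual (toHom x ((θ.unop.toOrderHom i.rev).rev).rev))
    rw [Fin.rev_rev]

end AntiIso

/-- The dual of a diagram. -/
def Diag.anti {P Q : Type} [Preorder P] [Preorder Q] {C C' : SSet.{w}} (b : AntiIso C C')
    (e : Pᵒᵈ ≃o Q) (τ : Diag P C) : Diag Q C' :=
  (AntiIso.nerve e).conj b τ

section

variable {P Q : Type} [Preorder P] [Preorder Q] {C C' : SSet.{w}} (b : AntiIso C C')

/-- The bijection between diagrams and their duals. -/
def Diag.antiEquiv (e : Pᵒᵈ ≃o Q) : Diag P C ≃ Diag Q C' where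
  toFun := Diag.anti b e
  invFun := (AntiIso.nerve e).symm.conj b.symm
  left_inv := (AntiIso.nerve e).symm_conj_conj b
  right_inv := (AntiIso.nerve e).conj_conj_symm b

/-- Duality commutes with restriction. This is the form in which bases, cones and subsquares are
identified with their duals, with `h` a check on elements. -/
lemma Diag.restr_anti {P' Q' : Type} [Preorder P'] [Preorder Q'] (e : Pᵒᵈ ≃o Q)
    (e' : P'ᵒᵈ ≃o Q') (f : P' →o P) (f' : Q' →o Q)
    (h : ∀ x, f' (e' (OrderDual.toDual x)) = e (OrderDual.toDual (f x))) (τ : Diag P C) :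
    (τ.anti b e).restr f' = (τ.restr f).anti b e' := by
  refine ext_ev fun n s ↦ ?_
  change b.equiv n (τ.app n (((AntiIso.nerve e).equiv n).symm (simplex (f'.comp s)))) =
    b.equiv n (τ.app n (simplex (f.comp (toHom (((AntiIso.nerve.{w} e').equiv n).symm (simplex s))))))
  refine congrArg (fun x ↦ b.equiv n (τ.app n x)) (ext_toHom fun i ↦ ?_)
  refine (e.symm_apply_eq (y := f' (s i.rev))).2 (Eq.trans ?_ (h _))
  exact congrArg f' (e'.apply_symm_apply _).symm

/-- The dual of an ordinal sum. -/
def dualSum (e : Pᵒᵈ ≃o Q) (n : ℕ) : (P ⊕ₗ Fin n)ᵒᵈ ≃o Fin n ⊕ₗ Q :=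
  (OrderIso.sumLexDualAntidistrib P (Fin n)).trans (OrderIso.sumLexCongr Fin.revOrderIso e)

/-- Slices under a diagram are dual to slices over the dual diagram. -/
def AntiIso.slice (e : Pᵒᵈ ≃o Q) (p : Diag P C) (p' : Diag Q C') (hp : p' = p.anti b e) :
    AntiIso (sliceUnder p) (sliceOver p') where
  equiv n := (Diag.antiEquiv b (dualSum e (n.unop.len + 1))).subtypeEquiv fun τ ↦ by
    refine Iff.trans ?_ (Eq.congr_left (Diag.restr_anti b (dualSum e (n.unop.len + 1)) e
      (lexSumInl _ _) (lexSumInr _ _) (fun _ ↦ rfl) τ)).symm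
    rw [hp]
    exact (Diag.antiEquiv b e).injective.eq_iff.symm
  equiv_map {n m} θ τ := Subtype.ext (Diag.restr_anti b (dualSum e (n.unop.len + 1))
    (dualSum e (m.unop.len + 1)) (lexSumMap OrderHom.id θ.unop.toOrderHom)
    (lexSumMap (SimplexCategory.rev.map θ.unop).toOrderHom OrderHom.id) (fun x ↦ by
      obtain ⟨a, rfl⟩ | ⟨a, rfl⟩ := lexSum_cases x
      · rfl
      · refine congrArg Sum.inlₗ ?_
        change (θ.unop.toOrderHom a.rev.rev).rev = (θ.unop.toOrderHom a).rev
        rw [Fin.rev_rev]) τ.1).symm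

end

/-- The duality of the square. -/
def squareDual : SquareShapeᵒᵈ ≃o SquareShape where
  toFun x := ((x.1.rev, x.2.rev) : Fin 2 × Fin 2)
  invFun x := ((x.1.rev, x.2.rev) : Fin 2 × Fin 2)
  left_inv _ := Prod.ext (Fin.rev_rev _) (Fin.rev_rev _)
  right_inv _ := Prod.ext (Fin.rev_rev _) (Fin.rev_rev _)
  map_rel_iff' := by intro x y; revert x y; decide

/-- Spans are dual to cospans. -/
def spanDual : SpanShapeᵒᵈ ≃o CospanShape where
  toFun x := ⟨squareDual x.1, by revert x; decide⟩
  invFun x := (⟨squareDual x.1, by revert x; decide⟩ : SpanShape)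
  left_inv _ := Subtype.ext (squareDual.symm_apply_apply _)
  right_inv _ := Subtype.ext (squareDual.apply_symm_apply _)
  map_rel_iff' := by intro x y; revert x y; decide

/-- The duality of the rectangle. -/
def rectangleDual : (Fin 2 × Fin 3)ᵒᵈ ≃o Fin 2 × Fin 3 where
  toFun x := (x.1.rev, x.2.rev)
  invFun x := ((x.1.rev, x.2.rev) : Fin 2 × Fin 3)
  left_inv _ := Prod.ext (Fin.rev_rev _) (Fin.rev_rev _)
  right_inv _ := Prod.ext (Fin.rev_rev _) (Fin.rev_rev _)
  map_rel_iff' := by intro x y; revert x y; decide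

variable {C C' : SSet.{w}} (b : AntiIso C C')

/-- The half turn `squareDual` exchanges spans with cospans and the corner `br` with `tl`, so the
cocone becomes the cone and `AntiIso.slice` exchanges initial with final. -/
lemma isPushoutSquare_iff (σ : Diag SquareShape C) :
    IsPushoutSquare σ ↔ IsPullbackSquare (σ.anti b squareDual) := by
  have hp : (σ.anti b squareDual).cospan = σ.span.anti b spanDual :=
    Diag.restr_anti b _ _ _ _ (fun _ ↦ rfl) σ
  refine ((AntiIso.slice b spanDual _ _ hp).isInitialVertex_iff _).trans ?_
  refine Iff.of_eq (congrArg (IsFinalVertex (S := sliceOver (σ.anti b squareDual).cospan)) ?_)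
  refine Subtype.ext (Diag.restr_anti b squareDual (dualSum spanDual 1) spanCoconeHom
    cospanConeHom (fun x ↦ ?_) σ).symm
  obtain ⟨a, rfl⟩ | ⟨a, rfl⟩ := lexSum_cases x <;> rfl

/-- The pasting law for pushout squares. -/
lemma isPushoutSquare_right_iff [Quasicategory C] (T : Diag (Fin 2 × Fin 3) C)
    (h : IsPushoutSquare (T.restr SquareShape.left)) :
    IsPushoutSquare (T.restr SquareShape.right) ↔ IsPushoutSquare (T.restr SquareShape.outer) := by
  let b := AntiIso.op C
  have := b.quasicategory
  rw [isPushoutSquare_iff b] at h ⊢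
  rw [isPushoutSquare_iff b]
  -- The half turn of the rectangle exchanges its left and right squares and preserves the outer
  -- one.
  rw [← Diag.restr_anti b rectangleDual squareDual _ SquareShape.right (by decide)] at h
  rw [← Diag.restr_anti b rectangleDual squareDual _ SquareShape.left (by decide),
    ← Diag.restr_anti b rectangleDual squareDual _ SquareShape.outer (by decide)]
  exact isPullbackSquare_left_iff _ h

lemma isPushoutSquare_swap_iff [Quasicategory C] (σ : Diag SquareShape C) :
    IsPushoutSquare (σ.restr SquareShape.swap) ↔ IsPushoutSquare σ := by
  let b := AntiIso.op C
  have := b.quasicategory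
  rw [isPushoutSquare_iff b, isPushoutSquare_iff b,
    ← Diag.restr_anti b squareDual squareDual _ SquareShape.swap (by decide),
    isPullbackSquare_swap_iff]

end Duality

/-! ### Gluing diagrams -/

namespace Diag

variable {C : SSet.{w}}

lemma edge_eq_ev {P : Type} [Preorder P] (τ : Diag P C) {x y : P} (h : x ≤ y)
    (s : Fin 2 →o P) (h₀ : s 0 = x) (h₁ : s 1 = y) : τ.edge h = τ.ev (n := op ⦋1⦌) s := by
  refine congrArg (τ.app (op ⦋1⦌)) (ext_toHom fun i ↦ ?_)
  obtain rfl | rfl : i = 0 ∨ i = 1 := by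
    revert i
    decide
  · exact h₀.symm
  · exact h₁.symm

/-- The nerve of `[1]` is `Δ¹`, so this is Yoneda. -/
lemma ext_edge {τ τ' : Diag (Fin 2) C}
    (h : τ.ev (n := op ⦋1⦌) OrderHom.id = τ'.ev (n := op ⦋1⦌) OrderHom.id) : τ = τ' := by
  refine ext_ev fun n s ↦ ?_
  let θ : op ⦋1⦌ ⟶ n := Quiver.Hom.op (X := n.unop) (Y := ⦋1⦌) (SimplexCategory.Hom.mk s)
  exact (τ.map_ev θ OrderHom.id).symm.trans ((congrArg (C.map θ) h).trans (τ'.map_ev θ OrderHom.id))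

/-- Gluing of two diagrams in a quasi-category along a common part, when there is an element `v`
strictly between any two comparable elements in the respective complements. -/
lemma exists_glue [SSet.Quasicategory C] {P₀ P₁ P₂ Q : Type} [PartialOrder P₀] [PartialOrder P₁]
    [PartialOrder P₂] [PartialOrder Q] {f₁ : P₁ →o Q} {f₂ : P₂ →o Q} {g₁ : P₀ →o P₁}
    {g₂ : P₀ →o P₂} (hf₁ : ∀ a b, f₁ a ≤ f₁ b ↔ a ≤ b) (hf₂ : ∀ a b, f₂ a ≤ f₂ b ↔ a ≤ b)
    (hg₁ : ∀ a b, g₁ a ≤ g₁ b ↔ a ≤ b) (hfg : ∀ a, f₁ (g₁ a) = f₂ (g₂ a))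
    (hinter : ∀ a b, f₁ a = f₂ b → a ∈ Set.range g₁) {v : Q}
    (hv : ∀ x ∉ Set.range f₂, ∀ y ∉ Set.range f₁, x ≤ y ∨ y ≤ x → x < v ∧ v < y)
    (hv' : ∀ x ∉ Set.range f₂, ∀ y ∉ Set.range f₁, x ≤ y ∨ y ≤ x →
      ∀ z, z ≤ x ∨ x ≤ z → z ≤ y ∨ y ≤ z → z ≤ v ∨ v ≤ z)
    (τ₁ : Diag P₁ C) (τ₂ : Diag P₂ C) (hτ : τ₁.restr g₁ = τ₂.restr g₂) :
    ∃ τ : Diag Q C, τ.restr f₁ = τ₁ ∧ τ.restr f₂ = τ₂ := by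
  -- The union of `N(P₁)` and `N(P₂)`. A chain outside it has a member `x` outside `P₂` and a member
  -- `y` outside `P₁`; since `x < v < y`, toggling `v` never removes either of them.
  let A : (SSet.uliftFunctor.{w, 0}.obj (nerve Q)).Subcomplex :=
    { obj n := {x | Set.range (toHom x) ⊆ Set.range f₁ ∨ Set.range (toHom x) ⊆ Set.range f₂}
      map {n n'} θ := by
        intro x hx
        have : Set.range (toHom ((SSet.uliftFunctor.{w, 0}.obj (nerve Q)).map θ x)) ⊆
            Set.range (toHom x) := by
          rintro _ ⟨i, rfl⟩
          exact ⟨_, rfl⟩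
        exact hx.imp (this.trans ·) (this.trans ·) }
  have hA {n : SimplexCategoryᵒᵖ} (s : Fin (n.unop.len + 1) →o Q) : simplex s ∈ A.obj n ↔
      Set.range s ⊆ Set.range f₁ ∨ Set.range s ⊆ Set.range f₂ := Iff.rfl
  have hA' {n : ℕ} {s : Fin (n + 1) →o Q} (hs : simplex (n := op ⦋n⦌) s ∉ A.obj _) :
      ∃ x ∈ Set.range s, x ∉ Set.range f₂ ∧ ∃ y ∈ Set.range s, y ∉ Set.range f₁ ∧
        (x ≤ y ∨ y ≤ x) := by
    rw [hA, not_or, Set.not_subset, Set.not_subset] at hs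
    obtain ⟨⟨y, hy, hy'⟩, ⟨x, hx, hx'⟩⟩ := hs
    exact ⟨x, hx, hx', y, hy, hy', comparable_of_mem_range s hx hy⟩
  have toggle : IsToggle A v := by
    constructor
    · intro n s hs q hq
      obtain ⟨x, hx, hx', y, hy, hy', h⟩ := hA' hs
      exact hv' x hx' y hy' h q (comparable_of_mem_range s hq hx)
        (comparable_of_mem_range s hq hy)
    · intro n s hs
      obtain ⟨x, hx, hx', y, hy, hy', h⟩ := hA' hs
      exact ⟨x, hx, (hv x hx' y hy' h).1⟩
    · intro n s hs
      obtain ⟨x, hx, hx', y, hy, hy', h⟩ := hA' hs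
      exact ⟨y, hy, (hv x hx' y hy' h).2⟩
    · intro n m s hs t ht
      obtain ⟨x, hx, hx', y, hy, hy', h⟩ := hA' hs
      rw [hA, not_or]
      refine ⟨fun h' ↦ hy' (h' ?_), fun h' ↦ hx' (h' ?_)⟩
      · exact ht.symm ▸ ⟨hy, (hv x hx' y hy' h).2.ne'⟩
      · exact ht.symm ▸ ⟨hx, (hv x hx' y hy' h).1.ne⟩
  -- A chain lying in both parts comes from `P₀` by `hinter`, where the diagrams agree.
  have key (n : SimplexCategoryᵒᵖ) (s₁ : Fin (n.unop.len + 1) →o P₁)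
      (s₂ : Fin (n.unop.len + 1) →o P₂) (h : f₁.comp s₁ = f₂.comp s₂) : τ₁.ev s₁ = τ₂.ev s₂ := by
    obtain ⟨s, rfl⟩ := exists_comp_eq_of_range_subset hg₁ s₁ (by
      rintro _ ⟨i, rfl⟩
      exact hinter _ _ (DFunLike.congr_fun h i))
    obtain rfl : s₂ = g₂.comp s := comp_injective_of_le_iff hf₂
      (h.symm.trans (OrderHom.ext _ _ (funext fun i ↦ hfg (s i))))
    exact congrArg (fun τ ↦ Diag.ev τ s) hτ
  obtain ⟨φ, hφ⟩ := exists_hom_of_rel (C := C) A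
    (fun n s c ↦ (∃ s₁ : Fin (n.unop.len + 1) →o P₁, s = f₁.comp s₁ ∧ c = τ₁.ev s₁) ∨
      ∃ s₂ : Fin (n.unop.len + 1) →o P₂, s = f₂.comp s₂ ∧ c = τ₂.ev s₂)
    (fun n s hs ↦ by
      obtain hs | hs := (hA s).1 hs
      · obtain ⟨s₁, h₁⟩ := exists_comp_eq_of_range_subset hf₁ s hs
        exact ⟨_, Or.inl ⟨s₁, h₁, rfl⟩⟩
      · obtain ⟨s₂, h₂⟩ := exists_comp_eq_of_range_subset hf₂ s hs
        exact ⟨_, Or.inr ⟨s₂, h₂, rfl⟩⟩)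
    (fun n s c c' h h' ↦ by
      obtain ⟨s₁, h₁, rfl⟩ | ⟨s₁, h₁, rfl⟩ := h <;> obtain ⟨s₂, h₂, rfl⟩ | ⟨s₂, h₂, rfl⟩ := h'
      · rw [comp_injective_of_le_iff hf₁ (h₁.symm.trans h₂)]
      · exact key n s₁ s₂ (h₁.symm.trans h₂)
      · exact (key n s₂ s₁ (h₂.symm.trans h₁)).symm
      · rw [comp_injective_of_le_iff hf₂ (h₁.symm.trans h₂)])
    (fun n m θ s c h ↦ by
      obtain ⟨s₁, rfl, rfl⟩ | ⟨s₁, rfl, rfl⟩ := h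
      · exact Or.inl ⟨s₁.comp θ.unop.toOrderHom, rfl, map_ev _ _ _⟩
      · exact Or.inr ⟨s₁.comp θ.unop.toOrderHom, rfl, map_ev _ _ _⟩)
  obtain ⟨τ, hτ'⟩ := toggle.exists_extension φ
  have h {n : SimplexCategoryᵒᵖ} (s : Fin (n.unop.len + 1) →o Q) (hs : simplex s ∈ A.obj n) :
      τ.ev s = φ.app n ⟨_, hs⟩ := ConcreteCategory.congr_hom (NatTrans.congr_app hτ' n) ⟨_, hs⟩
  refine ⟨τ, ext_ev fun n s ↦ ?_, ext_ev fun n s ↦ ?_⟩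
  · refine (h (f₁.comp s) ((hA _).2 (Or.inl ?_))).trans (hφ _ _ _ _ (Or.inl ⟨s, rfl, rfl⟩))
    rintro _ ⟨i, rfl⟩
    exact ⟨_, rfl⟩
  · refine (h (f₂.comp s) ((hA _).2 (Or.inr ?_))).trans (hφ _ _ _ _ (Or.inr ⟨s, rfl, rfl⟩))
    rintro _ ⟨i, rfl⟩
    exact ⟨_, rfl⟩

end Diag

/-! ### Gluing squares, and pushout squares in a stable ∞-category -/

section Rectangles

open Diag SSet

variable {C : SSet.{w}}

/-- The inclusion of the left edge of a square. -/
def leftEdge : Fin 2 →o SquareShape := ⟨fun i ↦ ((i, 0) : Fin 2 × Fin 2), fun _ _ h ↦ ⟨h, le_rfl⟩⟩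

/-- The inclusion of the right edge of a square. -/
def rightEdge : Fin 2 →o SquareShape := ⟨fun i ↦ ((i, 1) : Fin 2 × Fin 2), fun _ _ h ↦ ⟨h, le_rfl⟩⟩

/-- The rectangle without its top right corner. -/
abbrev NotchedRectangle : Type := {x : Fin 2 × Fin 3 // x ≠ (0, 2)}

/-- The square without its top right corner. -/
abbrev NotchedSquare : Type := {x : SquareShape // x ≠ tr}

set_option synthInstance.maxSize 2000 in
set_option synthInstance.maxHeartbeats 200000 in
/-- Two squares in a quasi-category with a common edge can be glued. -/
lemma exists_rectangle [Quasicategory C] (σ ρ : Diag SquareShape C)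
    (h : σ.restr rightEdge = ρ.restr leftEdge) :
    ∃ T : Diag (Fin 2 × Fin 3) C, T.restr SquareShape.left = σ ∧ T.restr SquareShape.right = ρ := by
  let f₁ : SquareShape →o NotchedRectangle :=
    ⟨fun x ↦ ⟨SquareShape.left x, by revert x; decide⟩, fun _ _ h ↦ SquareShape.left.monotone h⟩
  let f₂ : NotchedSquare →o NotchedRectangle :=
    ⟨fun x ↦ ⟨SquareShape.right x.1, by revert x; decide⟩,
      fun _ _ h ↦ SquareShape.right.monotone h⟩
  let g₂ : Fin 2 →o NotchedSquare :=
    ⟨fun i ↦ ⟨leftEdge i, by revert i; decide⟩, fun _ _ h ↦ leftEdge.monotone h⟩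
  -- Two gluings are needed because no single `v` serves both rows: chains from `(1, 0)` to `(1, 2)`
  -- require `(1, 1)`, and those from `(0, 0)` to `(0, 2)` require `(0, 1)`. The corner `(0, 2)`,
  -- incomparable to `(1, 1)`, is left out at first.
  obtain ⟨τ, h₁, h₂⟩ := exists_glue (f₁ := f₁) (f₂ := f₂) (g₁ := rightEdge) (g₂ := g₂)
    (v := ⟨(1, 1), by decide⟩) (by decide) (by decide) (by decide) (by decide) (by decide)
    (by simp only [lt_iff_le_not_ge]; decide) (by decide) σ
    (ρ.restr (OrderHom.Subtype.val _)) h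
  -- The only comparable pair left is `(0, 0) ≤ (0, 2)`, and `(0, 1)` lies strictly between.
  obtain ⟨T, h₃, h₄⟩ := exists_glue (f₁ := OrderHom.Subtype.val _) (f₂ := SquareShape.right)
    (g₁ := f₂) (g₂ := OrderHom.Subtype.val _) (v := (0, 1))
    (by decide) (by decide) (by decide) (by decide) (by decide)
    (by simp only [lt_iff_le_not_ge]; decide) (by decide) τ ρ h₂
  exact ⟨T, by rw [← h₁, ← h₃]; rfl, h₄⟩

/-- In a stable `∞`-category, if the left square and the outer square of a rectangle are fibre
sequences, then the right square is a pullback square. -/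
lemma IsStableInftyCategory.isPullbackSquare_right (hC : IsStableInftyCategory C)
    (T : Diag (Fin 2 × Fin 3) C) (hl : IsFibreSequence (T.restr SquareShape.left))
    (ho : IsFibreSequence (T.restr SquareShape.outer)) :
    IsPullbackSquare (T.restr SquareShape.right) := by
  have := hC.quasicategory
  -- As cofibre sequences, the left and outer squares are pushouts, and hence so is the right one.
  -- It remains to show that a pushout square `σ` is a pullback.
  have hr := (isPushoutSquare_right_iff T ((hC.fibre_iff_cofibre _).1 hl).2).2
    ((hC.fibre_iff_cofibre _).1 ho).2
  generalize T.restr SquareShape.right = σ at hr ⊢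
  obtain ⟨ρ, hρ, e⟩ := hC.exists_cofibre (σ.edge tr.le_br)
  -- The cofibre square of the right column of `σ` is transposed, so that this column becomes its
  -- left column and can be glued.
  obtain ⟨T', hT₁, hT₂⟩ := exists_rectangle σ (ρ.restr SquareShape.swap) (by
    refine ext_edge ((σ.edge_eq_ev tr.le_br rightEdge rfl rfl).symm.trans (e.symm.trans ?_))
    exact ρ.edge_eq_ev tr.tl_le (SquareShape.swap.comp leftEdge) rfl rfl)
  have hl' : IsPushoutSquare (T'.restr SquareShape.left) := by rwa [hT₁]
  have hr' : IsPushoutSquare (T'.restr SquareShape.right) := by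
    rw [hT₂, isPushoutSquare_swap_iff]
    exact hρ.2
  have hr'' : IsPullbackSquare (T'.restr SquareShape.right) := by
    rw [hT₂, isPullbackSquare_swap_iff]
    exact ((hC.fibre_iff_cofibre _).2 hρ).2
  -- The outer square is a pushout since both halves are. Its top right corner is the zero object of
  -- `ρ`; transposing moves it to the bottom left, where `IsTriangle` expects it.
  have ho' : IsCofibreSequence ((T'.restr SquareShape.outer).restr SquareShape.swap) := by
    refine ⟨?_, (isPushoutSquare_swap_iff _).2 ((isPushoutSquare_right_iff T' hl').1 hr')⟩
    have : ((T'.restr SquareShape.outer).restr SquareShape.swap).vertex bl =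
        (T'.restr SquareShape.right).vertex tr := rfl
    rw [IsTriangle, this, hT₂]
    exact hρ.1
  rw [← hT₁, isPullbackSquare_left_iff T' hr'', ← isPullbackSquare_swap_iff]
  exact ((hC.fibre_iff_cofibre _).2 ho').2

end Rectangles

/-! ### Rectangles in a category -/

section RectangleFunctor

variable {D : Type u} [Category.{v} D]

/-- A functor on the square is determined by its four edges: the diagonal is a composite, and there
is no morphism against the order. Equalities of such functors thus reduce to equalities of edges. -/
lemma functor_eq_squareFunctor (G : SquareShape ⥤ D) :
    G = squareFunctor { f₁₂ := G.map (homOfLE tr.tl_le), f₁₃ := G.map (homOfLE bl.tl_le),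
                        f₂₄ := G.map (homOfLE tr.le_br), f₃₄ := G.map (homOfLE bl.le_br),
                        fac := by rw [← G.map_comp, ← G.map_comp]; rfl } := by
  have key {x y : SquareShape} (h : ¬ x ≤ y) (f : x ⟶ y) {p : Prop} : p := (h (leOfHom f)).elim
  have key' {X Y : D} {a b : X ⟶ Y} (h : a = b) : a = eqToHom rfl ≫ b ≫ eqToHom rfl := by
    simpa using h
  refine CategoryTheory.Functor.ext (fun x ↦ ?_) fun x y f ↦ ?_
  · match x with
    | (0, 0) => rfl
    | (0, 1) => rfl
    | (1, 0) => rfl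
    | (1, 1) => rfl
  · match x, y, f with
    | (0, 0), (0, 0), f => exact key' ((G.map_id _).trans (Category.id_comp (𝟙 (G.obj tl))).symm)
    | (0, 0), (0, 1), f => exact key' ((Category.id_comp (X := G.obj tl) (Y := G.obj tr) _).symm)
    | (0, 0), (1, 0), f => exact key' ((Category.comp_id (X := G.obj tl) (Y := G.obj bl) _).symm)
    | (0, 0), (1, 1), f => exact key' (G.map_comp (homOfLE bl.tl_le) (homOfLE bl.le_br))
    | (0, 1), (0, 0), f => exact key (x := tr) (y := tl) (by decide) f
    | (0, 1), (0, 1), f => exact key' ((G.map_id _).trans (Category.id_comp (𝟙 (G.obj tr))).symm)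
    | (0, 1), (1, 0), f => exact key (x := tr) (y := bl) (by decide) f
    | (0, 1), (1, 1), f => exact key' ((Category.comp_id (X := G.obj tr) (Y := G.obj br) _).symm)
    | (1, 0), (0, 0), f => exact key (x := bl) (y := tl) (by decide) f
    | (1, 0), (0, 1), f => exact key (x := bl) (y := tr) (by decide) f
    | (1, 0), (1, 0), f => exact key' ((G.map_id _).trans (Category.id_comp (𝟙 (G.obj bl))).symm)
    | (1, 0), (1, 1), f => exact key' ((Category.id_comp (X := G.obj bl) (Y := G.obj br) _).symm)
    | (1, 1), (0, 0), f => exact key (x := br) (y := tl) (by decide) f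
    | (1, 1), (0, 1), f => exact key (x := br) (y := tr) (by decide) f
    | (1, 1), (1, 0), f => exact key (x := br) (y := bl) (by decide) f
    | (1, 1), (1, 1), f => exact key' ((G.map_id _).trans (Category.id_comp (𝟙 (G.obj br))).symm)

/-- The poset `[1] × [2]`, whose nerve is `Δ¹ × Δ²`. -/
def RectangleShape : Type := Fin 2 × Fin 3

/-- The separate type carries the category structure of a poset, as opposed to that of a product of
categories; `rectangleShapeToProd` compares them. -/
instance : PartialOrder RectangleShape := inferInstanceAs (PartialOrder (Fin 2 × Fin 3))

/-- The identification of the poset `[1] × [2]` with the product of the categories `[1]` and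
`[2]`. -/
def rectangleShapeToProd : RectangleShape ⥤ Fin 2 × Fin 3 where
  obj x := x
  map f := Prod.mkHom (homOfLE (leOfHom f).1) (homOfLE (leOfHom f).2)

variable {X₀ X₁ X₂ Y₀ Y₁ Y₂ : D} {f : X₀ ⟶ X₁} {g : X₁ ⟶ X₂} {f' : Y₀ ⟶ Y₁} {g' : Y₁ ⟶ Y₂}
  {a₀ : X₀ ⟶ Y₀} {a₁ : X₁ ⟶ Y₁} {a₂ : X₂ ⟶ Y₂}

/-- The functor given by two adjacent commutative squares. -/
def rectangleFunctor (h : f ≫ a₁ = a₀ ≫ f') (h' : g ≫ a₂ = a₁ ≫ g') : RectangleShape ⥤ D :=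
  rectangleShapeToProd ⋙ Functor.uncurry.obj (ComposableArrows.mk₁
    (ComposableArrows.homMk₂ a₀ a₁ a₂ h h' :
      ComposableArrows.mk₂ f g ⟶ ComposableArrows.mk₂ f' g'))

/-- The inclusion of the left square of a rectangle. -/
def rectangleLeft : SquareShape →o RectangleShape := SquareShape.left

/-- The inclusion of the right square of a rectangle. -/
def rectangleRight : SquareShape →o RectangleShape := SquareShape.right

/-- The inclusion of the outer square of a rectangle. -/
def rectangleOuter : SquareShape →o RectangleShape := SquareShape.outer

/-- An equality, and not merely an isomorphism, of functors: it lets the images of the three squares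
be literal restrictions of one diagram in `C`. -/
lemma left_rectangleFunctor (h : f ≫ a₁ = a₀ ≫ f') (h' : g ≫ a₂ = a₁ ≫ g') :
    rectangleLeft.monotone.functor ⋙ rectangleFunctor h h' =
      squareFunctor { f₁₂ := f, f₁₃ := a₀, f₂₄ := a₁, f₃₄ := f', fac := h } := by
  rw [functor_eq_squareFunctor (rectangleLeft.monotone.functor ⋙ rectangleFunctor h h')]
  have e₁ : (rectangleLeft.monotone.functor ⋙ rectangleFunctor h h').map
    (homOfLE tr.tl_le) = f := Category.id_comp _
  have e₂ : (rectangleLeft.monotone.functor ⋙ rectangleFunctor h h').map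
    (homOfLE bl.tl_le) = a₀ := Category.comp_id _
  have e₃ : (rectangleLeft.monotone.functor ⋙ rectangleFunctor h h').map
    (homOfLE tr.le_br) = a₁ := Category.comp_id _
  have e₄ : (rectangleLeft.monotone.functor ⋙ rectangleFunctor h h').map
    (homOfLE bl.le_br) = f' := Category.id_comp _
  congr 1
  congr 1

lemma right_rectangleFunctor (h : f ≫ a₁ = a₀ ≫ f') (h' : g ≫ a₂ = a₁ ≫ g') :
    rectangleRight.monotone.functor ⋙ rectangleFunctor h h' =
      squareFunctor { f₁₂ := g, f₁₃ := a₁, f₂₄ := a₂, f₃₄ := g', fac := h' } := by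
  rw [functor_eq_squareFunctor (rectangleRight.monotone.functor ⋙ rectangleFunctor h h')]
  have e₁ : (rectangleRight.monotone.functor ⋙ rectangleFunctor h h').map
    (homOfLE tr.tl_le) = g := Category.id_comp _
  have e₂ : (rectangleRight.monotone.functor ⋙ rectangleFunctor h h').map
    (homOfLE bl.tl_le) = a₁ := Category.comp_id _
  have e₃ : (rectangleRight.monotone.functor ⋙ rectangleFunctor h h').map
    (homOfLE tr.le_br) = a₂ := Category.comp_id _
  have e₄ : (rectangleRight.monotone.functor ⋙ rectangleFunctor h h').map
    (homOfLE bl.le_br) = g' := Category.id_comp _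
  congr 1
  congr 1

lemma outer_rectangleFunctor (h : f ≫ a₁ = a₀ ≫ f') (h' : g ≫ a₂ = a₁ ≫ g') {fg : X₀ ⟶ X₂}
    {fg' : Y₀ ⟶ Y₂} (hf : f ≫ g = fg) (hf' : f' ≫ g' = fg') (h'' : fg ≫ a₂ = a₀ ≫ fg') :
    rectangleOuter.monotone.functor ⋙ rectangleFunctor h h' =
      squareFunctor { f₁₂ := fg, f₁₃ := a₀, f₂₄ := a₂, f₃₄ := fg', fac := h'' } := by
  subst hf hf'
  rw [functor_eq_squareFunctor (rectangleOuter.monotone.functor ⋙ rectangleFunctor h h')]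
  have e₁ : (rectangleOuter.monotone.functor ⋙ rectangleFunctor h h').map
    (homOfLE tr.tl_le) = f ≫ g := Category.id_comp _
  have e₂ : (rectangleOuter.monotone.functor ⋙ rectangleFunctor h h').map
    (homOfLE bl.tl_le) = a₀ := Category.comp_id _
  have e₃ : (rectangleOuter.monotone.functor ⋙ rectangleFunctor h h').map
    (homOfLE tr.le_br) = a₂ := Category.comp_id _
  have e₄ : (rectangleOuter.monotone.functor ⋙ rectangleFunctor h h').map
    (homOfLE bl.le_br) = f' ≫ g' := Category.id_comp _
  congr 1
  congr 1

/-- Let `F` be a functor to a stable `∞`-category. If `F` sends the left and the outer square of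
a rectangle to fibre sequences, then it sends the right square to a pullback square. -/
lemma IsStableInftyCategory.isPullbackSquare_mapSquare {C : SSet.{max u v w}}
    (hC : IsStableInftyCategory C) (F : InftyFunctor.{w} D C)
    (h : f ≫ a₁ = a₀ ≫ f') (h' : g ≫ a₂ = a₁ ≫ g') {fg : X₀ ⟶ X₂}
    {fg' : Y₀ ⟶ Y₂} (hf : f ≫ g = fg) (hf' : f' ≫ g' = fg') (h'' : fg ≫ a₂ = a₀ ≫ fg')
    (hl : IsFibreSequence
      (F.mapSquare { f₁₂ := f, f₁₃ := a₀, f₂₄ := a₁, f₃₄ := f', fac := h }))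
    (ho : IsFibreSequence
      (F.mapSquare { f₁₂ := fg, f₁₃ := a₀, f₂₄ := a₂, f₃₄ := fg', fac := h'' })) :
    IsPullbackSquare (F.mapSquare { f₁₂ := g, f₁₃ := a₁, f₂₄ := a₂, f₃₄ := g', fac := h' }) := by
  rw [InftyFunctor.mapSquare, ← left_rectangleFunctor h h'] at hl
  rw [InftyFunctor.mapSquare, ← outer_rectangleFunctor h h' hf hf'] at ho
  rw [InftyFunctor.mapSquare, ← right_rectangleFunctor h h']
  exact hC.isPullbackSquare_right (F.comp (rectangleFunctor h h')) hl ho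

end RectangleFunctor

/-! ### Abstract blowup squares -/

namespace Variety

variable {k : Type u} [Field k]

/-- Open immersions into a locally Noetherian scheme are quasi-compact, so open subschemes of a
variety are again of finite type. -/
instance (X : Variety k) : IsLocallyNoetherian X.sch :=
  LocallyOfFiniteType.isLocallyNoetherian X.str

/-- An open subscheme of a variety, considered as a variety. -/
noncomputable def ofOpens {X : Variety k} (V : X.sch.Opens) : Variety k where
  obj := Over.mk (V.ι ≫ X.str)
  property := ⟨inferInstanceAs (IsReduced (V : Scheme.{u})),
    inferInstanceAs (IsSeparated (V.ι ≫ X.str)), inferInstanceAs (LocallyOfFiniteType (V.ι ≫ X.str)),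
    inferInstanceAs (QuasiCompact (V.ι ≫ X.str))⟩

/-- A morphism of schemes over `k` between varieties, considered as a morphism of varieties. -/
noncomputable def homMk {X Y : Variety k} (f : X.sch ⟶ Y.sch) (h : f ≫ Y.str = X.str) : X ⟶ Y :=
  ObjectProperty.homMk (Over.homMk f h)

/-- In a Cartesian square of varieties, a pair of points with the same image comes from a point of
the fibre product. -/
lemma exists_preimage {E Y C X : Variety k} {i' : E ⟶ Y} {p' : E ⟶ C} {p : Y ⟶ X} {i : C ⟶ X}
    (h : IsPullback i' p' p i) {y : Y.sch} {c : C.sch} (hyc : mor p y = mor i c) :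
    ∃ e, mor i' e = y := by
  let P := Limits.pullback (mor p) (mor i)
  obtain ⟨z, hz, -⟩ : ∃ z : P, Limits.pullback.fst (mor p) (mor i) z = y ∧ _ :=
    Scheme.Pullback.exists_preimage_pullback y c hyc
  have : LocallyOfFiniteType (mor i ≫ X.str) := by rw [mor_str]; infer_instance
  have : IsSeparated (mor i ≫ X.str) := by rw [mor_str]; infer_instance
  have : QuasiCompact (mor i ≫ X.str) := by rw [mor_str]; infer_instance
  have : LocallyOfFiniteType (mor i) := locallyOfFiniteType_of_comp _ X.str
  have : IsSeparated (mor i) := IsSeparated.of_comp _ X.str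
  have : QuasiCompact (mor i) := QuasiCompact.of_comp _ X.str
  let s : P ⟶ Spec (CommRingCat.of k) := Limits.pullback.fst _ _ ≫ Y.str
  have : IsSeparated s := inferInstanceAs (IsSeparated (_ ≫ _))
  -- `E` is a fibre product only among varieties, so `z` cannot be lifted directly. Its closure with
  -- the reduced structure, the image of `l`, is a variety `Q` mapping to `Y` and `C`, and hence to
  -- `E`.
  let l := P.fromSpecResidueField z
  have : QuasiCompact l := QuasiCompact.of_comp l s
  have : IsReduced l.image := isReduced_image l
  let Q : Variety k :=
    { obj := Over.mk (l.imageι ≫ s)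
      property := ⟨this, inferInstanceAs (IsSeparated (l.imageι ≫ Limits.pullback.fst _ _ ≫ Y.str)),
        inferInstanceAs (LocallyOfFiniteType (l.imageι ≫ Limits.pullback.fst _ _ ≫ Y.str)),
        inferInstanceAs (QuasiCompact (l.imageι ≫ Limits.pullback.fst _ _ ≫ Y.str))⟩ }
  let a : Q ⟶ Y := homMk (l.imageι ≫ Limits.pullback.fst _ _) (Category.assoc _ _ _)
  have hb : (l.imageι ≫ Limits.pullback.snd (mor p) (mor i)) ≫ C.str = l.imageι ≫ s := by
    rw [Category.assoc]
    congr 1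
    rw [← mor_str i, ← Limits.pullback.condition_assoc, mor_str]
  let b : Q ⟶ C := homMk (l.imageι ≫ Limits.pullback.snd _ _) hb
  have hab : a ≫ p = b ≫ i := by
    apply ObjectProperty.hom_ext
    apply Over.OverMorphism.ext
    change (l.imageι ≫ Limits.pullback.fst _ _) ≫ mor p =
      (l.imageι ≫ Limits.pullback.snd _ _) ≫ mor i
    rw [Category.assoc, Category.assoc, Limits.pullback.condition]
  obtain ⟨x, hx⟩ : z ∈ Set.range l := by
    rw [Scheme.range_fromSpecResidueField]
    rfl
  refine ⟨mor (h.lift a b hab) (l.toImage x), ?_⟩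
  have h₁ : mor (h.lift a b hab) ≫ mor i' = l.imageι ≫ Limits.pullback.fst _ _ :=
    congr(mor $(h.lift_fst a b hab))
  refine Eq.trans ?_ ((congrArg (Limits.pullback.fst (mor p) (mor i)) hx).trans hz)
  refine (Scheme.Hom.comp_apply _ _ _).symm.trans ?_
  rw [h₁]
  refine (Scheme.Hom.comp_apply _ _ _).trans (congrArg _ ?_)
  refine (Scheme.Hom.comp_apply _ _ _).symm.trans ?_
  rw [Scheme.Hom.toImage_imageι]

namespace IsAbstractBlowupSquare

variable {E Y C X : Variety k} {i' : E ⟶ Y} {p' : E ⟶ C} {p : Y ⟶ X} {i : C ⟶ X}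

/-- `E` is closed in the scheme-theoretic fibre product, whose projection to `Y` is a base change of
`i`. -/
lemma isClosedImmersion_top (h : IsAbstractBlowupSquare i' p' p i) : IsClosedImmersion (mor i') := by
  have := isClosedImmersion_lift h.isPullback
  have := h.isClosedImmersion
  rw [← Limits.pullback.lift_fst (f := mor p) (g := mor i) (mor i') (mor p')
      (show mor i' ≫ mor p = mor p' ≫ mor i from congr(mor $h.isPullback.w))]
  infer_instance

end IsAbstractBlowupSquare

/-- The composite is defined on `p⁻¹(U)`, which by `h` is the image of `j'`; the maps to `U` are
compared after composing with the monomorphism `j`. -/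
lemma spanOfProper_comp_spanOfOpen {U X Y : Variety k} (p : Y ⟶ X) (j : U ⟶ X) (j' : U ⟶ Y)
    [IsProper (mor p)] [IsOpenImmersion (mor j)] [IsOpenImmersion (mor j')]
    (w : j' ≫ p = j) (h : Set.range (mor j') = mor p ⁻¹' Set.range (mor j)) :
    spanOfProper p ≫ spanOfOpen j = spanOfOpen j' := by
  have hd : ProperSpan.compDom (spanOfProper p) (spanOfOpen j) = (mor j').opensRange := by
    ext x
    rw [SetLike.mem_coe, SetLike.mem_coe, ProperSpan.mem_compDom]
    refine Iff.trans ⟨fun ⟨_, hx⟩ ↦ hx, fun hx ↦ ⟨trivial, hx⟩⟩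
      (Set.ext_iff.1 h x).symm
  refine ProperSpan.ext_of_le hd ?_
  rw [← cancel_mono (mor j)]
  have h₁ := ProperSpan.compProj_ι (spanOfProper p) (spanOfOpen j)
  have h₂ : (mor j).isoOpensRange.inv ≫ mor j = (mor j).opensRange.ι :=
    (mor j).isoOpensRange_inv_comp
  have h₃ : (mor j').isoOpensRange.inv ≫ mor j = (mor j').opensRange.ι ≫ mor p := by
    rw [← w]
    change _ ≫ mor j' ≫ mor p = _
    rw [Scheme.Hom.isoOpensRange_inv_comp_assoc]
  have h₄ : Y.sch.homOfLE (ProperSpan.compDom_le (spanOfProper p) (spanOfOpen j)) ≫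
      Scheme.Opens.ι ⊤ ≫ mor p = Y.sch.homOfLE hd.le ≫ (mor j').opensRange.ι ≫ mor p :=
    (Scheme.homOfLE_ι_assoc _ _ _).trans (Scheme.homOfLE_ι_assoc _ _ _).symm
  exact (Category.assoc _ _ _).trans ((congrArg
    (ProperSpan.compProj (spanOfProper p) (spanOfOpen j) ≫ ·) h₂).trans ((h₁.trans h₄).trans
      ((Category.assoc _ _ _).trans (congrArg (Y.sch.homOfLE hd.le ≫ ·) h₃)).symm))

lemma spanOfProper_comp_spanToEmpty {C E : Variety k} (p : E ⟶ C) [IsProper (mor p)] :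
    spanOfProper p ≫ spanToEmpty C = spanToEmpty E := by
  have h : ProperSpan.compDom (spanOfProper p) (spanToEmpty C) = ⊥ := by
    ext x
    rw [SetLike.mem_coe, SetLike.mem_coe, ProperSpan.mem_compDom]
    exact ⟨fun ⟨_, hx⟩ ↦ hx, fun hx ↦ hx.elim⟩
  refine ProperSpan.ext_of_le h ?_
  have : IsEmpty (ProperSpan.compDom (spanOfProper p) (spanToEmpty C) : Scheme.{u}) := by
    rw [h]
    infer_instance
  exact isInitialOfIsEmpty.hom_ext _ _

end Variety

/-! ### Descent for abstract blowup squares -/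

theorem proposition6p7 {k : Type u} [Field k] {C : SSet.{max (u + 1) w}}
    (hC : IsStableInftyCategory C) (F : InftyFunctor.{w} (VarSpan k)ᵒᵖ C)
    (hF : HasLocalisationProperty F) : HasAbstractBlowupDescent F := by
  intro E Y Z X i' p' p i h
  have hi := h.isClosedImmersion
  have hi' := h.isClosedImmersion_top
  have hp := h.isProper
  have hp' := h.isProper_left
  let V : X.sch.Opens := ⟨(Set.range (Variety.mor i))ᶜ,
    (Variety.mor i).isClosedEmbedding.isClosed_range.isOpen_compl⟩
  have hV : IsIso (Variety.mor p ∣_ V) := h.isIso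
  -- The inverse of `p` over `V = X ∖ C` embeds `V` as the open subscheme `p⁻¹(V)` of `Y`.
  let m : (V : Scheme.{u}) ⟶ Y.sch := inv (Variety.mor p ∣_ V) ≫ (Variety.mor p ⁻¹ᵁ V).ι
  have hm : m ≫ Variety.mor p = V.ι := by
    rw [Category.assoc, ← morphismRestrict_ι, IsIso.inv_hom_id_assoc]
  let j : Variety.ofOpens V ⟶ X := Variety.homMk V.ι rfl
  let j' : Variety.ofOpens V ⟶ Y := Variety.homMk m (by
    change m ≫ Y.str = V.ι ≫ X.str
    rw [← Variety.mor_str p, reassoc_of% hm])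
  have hj : IsOpenImmersion (Variety.mor j) := inferInstanceAs (IsOpenImmersion V.ι)
  have hj' : IsOpenImmersion (Variety.mor j') :=
    inferInstanceAs (IsOpenImmersion (inv (Variety.mor p ∣_ V) ≫ (Variety.mor p ⁻¹ᵁ V).ι))
  have w : j' ≫ p = j := ObjectProperty.hom_ext _ (Over.OverMorphism.ext hm)
  have hrj : Set.range (Variety.mor j) = (Set.range (Variety.mor i))ᶜ := V.range_ι
  have hrj' : Set.range (Variety.mor j') = Variety.mor p ⁻¹' Set.range (Variety.mor j) := by
    ext y
    constructor
    · rintro ⟨v, rfl⟩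
      exact ⟨v, (congrArg (fun f ↦ f v) hm).symm.trans (Scheme.Hom.comp_apply _ _ _)⟩
    · intro hy
      rw [hrj] at hy
      have hm' : (Variety.mor p ∣_ V) ≫ m = (Variety.mor p ⁻¹ᵁ V).ι := IsIso.hom_inv_id_assoc _ _
      exact ⟨(Variety.mor p ∣_ V) ⟨y, hy⟩,
        (Scheme.Hom.comp_apply _ _ _).symm.trans (congrArg (fun f ↦ f ⟨y, hy⟩) hm')⟩
  have hri : Set.range (Variety.mor i) = (Set.range (Variety.mor j))ᶜ := by
    rw [hrj, compl_compl]
  -- The complement of `V` in `Y` is the preimage of the image of `i`. It is the image of `i'`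
  -- because `E` has enough points.
  have hri' : Set.range (Variety.mor i') = (Set.range (Variety.mor j'))ᶜ := by
    rw [hrj', hrj, Set.preimage_compl, compl_compl]
    ext y
    refine ⟨?_, fun ⟨c, hc⟩ ↦ Variety.exists_preimage h.isPullback hc.symm⟩
    rintro ⟨e, rfl⟩
    refine ⟨Variety.mor p' e, ?_⟩
    rw [← Scheme.Hom.comp_apply, ← Scheme.Hom.comp_apply]
    exact congrArg (fun f ↦ Variety.mor f e) h.isPullback.w.symm
  -- The rectangle in the opposite of `Span` has rows `U → X → Y` and `∅ → C → E`; the localisation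
  -- squares of `U` in `X` and in `Y` are its left and outer squares.
  exact hC.isPullbackSquare_mapSquare F
    (Variety.localisationSquare i j hri).op.fac h.square.op.fac
    (congrArg Quiver.Hom.op (Variety.spanOfProper_comp_spanOfOpen p j j' w hrj'))
    (congrArg Quiver.Hom.op (Variety.spanOfProper_comp_spanToEmpty p'))
    (Variety.localisationSquare i' j' hri').op.fac (hF i j hri) (hF i' j' hri')
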